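/- All graphs are finite and simple, and an embedding $f$ of a graph $G$ is a piecewise linear embedding of $G$ into $\mathbb{R}^3$. A knot in $f(G)$ is the image of a cycle of $G$; it is nontrivial if no finite sequence of elementary deformations (replacing a segment $pq$ of the knot by $pr\cup rq$, where the triangle $pqr$ meets the knot exactly in $pq$) and their inverses turns it into the boundary of a triangle. A link in $f(G)$ is the image of an unordered pair $\{\gamma,\delta\}$ of vertex-disjoint cycles of $G$; its linking number $\operatorname{lk}$ is half of the sum of the signs of the crossings between the two components in a regular projection, for any orientations of the components (so $|\operatorname{lk}|$ is well defined). The embedding $f$ is knotted if $f(G)$ contains a nontrivial knot. It is complexly algebraically linked (CA-linked) if $f(G)$ contains a link $L$ with $|\operatorname{lk}(L)|\ge 2$, or more than one link with nonzero linking number. A graph is K-linked if every CA-linked embedding of it is knotted. A graph $G'$ is obtained from $G$ by a $\nabla Y$-move if, for some triangle $abc$ of $G$, $G'$ is (isomorphic to) the graph obtained from $G$ by deleting the edges $ab$, $bc$, $ca$ and adding one new vertex joined to exactly $a$, $b$ and $c$. Lemma. Let $G'$ be obtained from $G$ by a $\nabla Y$-move. If $G$ is K-linked, then $G'$ is K-linked.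 -/

import Mathlib

namespace KnotLink

/-- Three-space as a real affine space; the norm that `Fin 3 → ℝ` carries is never used. -/
abbrev Space := Fin 3 → ℝ

/-! ### Polygonal arcs -/

/-- The polygonal path with the given successive vertices, as a set of points. -/
def carrier : List Space → Set Space
  | [] => ∅
  | [x] => {x}
  | x :: y :: l => segment ℝ x y ∪ carrier (y :: l)

/-- The polygonal path with the given successive vertices does not meet itself: every edge is
nondegenerate and meets the part of the path that follows it only in its own end point. -/
def IsSimpleArc : List Space → Prop
  | [] => False
  | [_] => True
  | x :: y :: l => x ≠ y ∧ segment ℝ x y ∩ carrier (y :: l) = {y} ∧ IsSimpleArc (y :: l)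

/-- The oriented edges of a polygonal path. -/
def edges (P : List Space) : List (Space × Space) := P.zip P.tail

/-! ### Piecewise linear embeddings of graphs -/

/-- A piecewise linear embedding of the graph `G` in three-space: points for the vertices and, for
every edge, a simple polygonal arc joining the images of its ends, such that arcs and vertices meet
only as they have to. -/
structure SpatialGraph {V : Type*} (G : SimpleGraph V) where
  /-- the image of a vertex -/
  pos : V → Space
  /-- the interior break points of the image of the edge `uv`, in the order from `u` to `v`
  (irrelevant when `u` and `v` are not adjacent) -/
  bend : V → V → List Space
  bend_symm : ∀ u v, G.Adj u v → bend v u = (bend u v).reverse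
  pos_injective : Function.Injective pos
  arc_simple : ∀ u v, G.Adj u v → IsSimpleArc (pos u :: (bend u v ++ [pos v]))
  vertex_arc : ∀ u v w, G.Adj u v → pos w ∈ carrier (pos u :: (bend u v ++ [pos v])) →
    w = u ∨ w = v
  arc_arc : ∀ u v x y, G.Adj u v → G.Adj x y → s(u, v) ≠ s(x, y) →
    carrier (pos u :: (bend u v ++ [pos v])) ∩ carrier (pos x :: (bend x y ++ [pos y])) ⊆
      pos '' ({u, v} ∩ {x, y})

/-- The polygonal path that is the image of a walk. For a closed walk the first and the last point
of the list agree. -/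
def SpatialGraph.track {V : Type*} {G : SimpleGraph V} (f : SpatialGraph G) :
    ∀ {u v : V}, G.Walk u v → List Space
  | u, _, .nil => [f.pos u]
  | u, _, .cons (v := v) _ p => f.pos u :: (f.bend u v ++ f.track p)

/-! ### Knots -/

/-- Elementary deformation (triangle move) of a polygonal knot: if a triangle `pqr` meets the knot
`K` exactly in the segment `pq`, then this segment is replaced by the other two sides. -/
def ElementaryMove (K K' : Set Space) : Prop :=
  ∃ p q r : Space, AffineIndependent ℝ ![p, q, r] ∧
    convexHull ℝ {p, q, r} ∩ K = segment ℝ p q ∧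
    K' = (K \ openSegment ℝ p q) ∪ (segment ℝ p r ∪ segment ℝ r q)

/-- Equivalence of polygonal knots: a finite sequence of elementary deformations and their
inverses. -/
def KnotEquiv : Set Space → Set Space → Prop := Relation.EqvGen ElementaryMove

/-- A polygonal knot is trivial if it is equivalent to the boundary of a triangle. -/
def IsTrivialKnot (K : Set Space) : Prop :=
  ∃ p q r : Space, AffineIndependent ℝ ![p, q, r] ∧
    KnotEquiv K (segment ℝ p q ∪ (segment ℝ q r ∪ segment ℝ r p))

/-- An embedding is knotted if the image of some cycle is a nontrivial knot. -/
def SpatialGraph.Knotted {V : Type*} {G : SimpleGraph V} (f : SpatialGraph G) : Prop :=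
  ∃ (u : V) (c : G.Walk u u), c.IsCycle ∧ ¬ IsTrivialKnot (carrier (f.track c))

/-! ### Linking numbers -/

/-- The linear projection `π` of three-space onto the plane is regular for the pair of polygonal
paths `P`, `Q`: wherever the projection of an edge of `P` meets that of an edge of `Q`, the two
edges cross transversely, at interior points of both. -/
def IsRegularProjection (π : Space →ₗ[ℝ] (Fin 2 → ℝ)) (P Q : List Space) : Prop :=
  Function.Surjective π ∧
    ∀ e ∈ edges P, ∀ e' ∈ edges Q, ∀ x ∈ segment ℝ e.1 e.2, ∀ y ∈ segment ℝ e'.1 e'.2, π x = π y →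
      x ∈ openSegment ℝ e.1 e.2 ∧ y ∈ openSegment ℝ e'.1 e'.2 ∧
        LinearIndependent ℝ ![π (e.2 - e.1), π (e'.2 - e'.1)]

open Classical in
/-- The sign of the crossing of two oriented edges `ab` and `cd` under the projection `π`, and `0`
if their projections are disjoint. If `x` on `ab` and `y` on `cd` have the same projection, then the
sign of the crossing is that of `det (b - a, d - c, x - y)`, and this determinant is equal to
`det (b - a, d - c, a - c)` since `x - a` and `y - c` are multiples of `b - a` and `d - c`. -/
noncomputable def crossingSign (π : Space →ₗ[ℝ] (Fin 2 → ℝ)) (e e' : Space × Space) : ℤ :=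
  if (π '' segment ℝ e.1 e.2 ∩ π '' segment ℝ e'.1 e'.2).Nonempty then
    (SignType.sign (Matrix.det (Matrix.of ![e.2 - e.1, e'.2 - e'.1, e.1 - e'.1])) : ℤ)
  else 0

/-- The sum of the signs of all crossings between two polygonal paths under the projection `π`. -/
noncomputable def crossingSum (π : Space →ₗ[ℝ] (Fin 2 → ℝ)) (P Q : List Space) : ℤ :=
  ((edges P).map fun e => ((edges Q).map fun e' => crossingSign π e e').sum).sum

/-- Two subgraphs are disjoint cycles of the graph, that is, they form a link in every embedding. -/
def IsLink {V : Type*} {G : SimpleGraph V} (γ δ : G.Subgraph) : Prop :=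
  (∃ (u : V) (c : G.Walk u u), c.IsCycle ∧ c.toSubgraph = γ) ∧
  (∃ (u : V) (c : G.Walk u u), c.IsCycle ∧ c.toSubgraph = δ) ∧
  Disjoint γ.verts δ.verts

/-- For some orientations of the disjoint cycles `γ` and `δ`, the linking number of their images is
`n`: half of the sum of the signs of the crossings between them in a regular projection. The
orientations are those of the closed walks `c` and `c'`; they affect only the sign of `n`. -/
def SpatialGraph.HasLinkingNumber {V : Type*} {G : SimpleGraph V} (f : SpatialGraph G)
    (γ δ : G.Subgraph) (n : ℤ) : Prop :=
  ∃ (u v : V) (c : G.Walk u u) (c' : G.Walk v v) (π : Space →ₗ[ℝ] (Fin 2 → ℝ)),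
    c.IsCycle ∧ c.toSubgraph = γ ∧ c'.IsCycle ∧ c'.toSubgraph = δ ∧
    IsRegularProjection π (f.track c) (f.track c') ∧
    crossingSum π (f.track c) (f.track c') = 2 * n

/-- Complexly algebraically linked: some link has linking number at least two in absolute value, or
two different links (unordered pairs of disjoint cycles) have nonzero linking number. -/
def SpatialGraph.CALinked {V : Type*} {G : SimpleGraph V} (f : SpatialGraph G) : Prop :=
  (∃ (γ δ : G.Subgraph) (n : ℤ), IsLink γ δ ∧ f.HasLinkingNumber γ δ n ∧ 2 ≤ |n|) ∨
  (∃ (γ δ γ' δ' : G.Subgraph) (n n' : ℤ), IsLink γ δ ∧ IsLink γ' δ' ∧ s(γ, δ) ≠ s(γ', δ') ∧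
    f.HasLinkingNumber γ δ n ∧ n ≠ 0 ∧ f.HasLinkingNumber γ' δ' n' ∧ n' ≠ 0)

/-- A graph is K-linked if all its CA-linked embeddings are knotted. -/
def KLinked {V : Type*} (G : SimpleGraph V) : Prop :=
  ∀ f : SpatialGraph G, f.CALinked → f.Knotted

/-! ### The move from a triangle to a Y -/

/-- The edges `ab`, `bc`, `ca` are deleted and a new vertex `none`, joined to exactly `a`, `b` and
`c`, is added. -/
def triangleY {V : Type*} (G : SimpleGraph V) (a b c : V) : SimpleGraph (Option V) :=
  (G.deleteEdges {s(a, b), s(b, c), s(c, a)}).map some ⊔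
    SimpleGraph.fromEdgeSet {s(none, some a), s(none, some b), s(none, some c)}

/-- `G'` is obtained, up to isomorphism, from `G` by replacing a triangle by a Y. -/
def IsTriangleYMove {V V' : Type*} (G : SimpleGraph V) (G' : SimpleGraph V') : Prop :=
  ∃ a b c : V, G.Adj a b ∧ G.Adj b c ∧ G.Adj c a ∧ Nonempty (G' ≃g triangleY G a b c)

end KnotLink

namespace KnotLink

/-! ### Polygonal paths -/

/-! Let `f` be a CA-linked embedding of `G'`. An embedding of `G` very close to it is obtained by
drawing each edge `xy` of the triangle parallel to the path that runs along two arms of the Y from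
`x` through the centre to `y`. A short vector `w` is chosen transverse to the whole image
(`exists_thick`), and the inner parts of the three paths are shifted by 1, 0 and -1 times `w`, for
`ab`, `bc` and `ca`. Near the image, foot point and height are unique coordinates, so the new edges
meet only in common ends; this is `YMove.embed`.

Links: a cycle of `G'` through the centre uses exactly two arms, and trading them for the parallel
edge of the triangle gives a cycle of `G`; other cycles are unchanged. This preserves disjointness
and is injective (`Corresponds.unique`). As `w` shrinks, the new cycles tend to the old ones, and a
regular projection of two disjoint polygons stays regular, with the same crossing signs, under small
perturbations (`eventually_isRegularProjection`). The same projection therefore computes the same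
linking numbers, and the new embedding is CA-linked (`eventually_caLinked`); independence of the
projection is never needed.

Knots: since `G` is K-linked, some cycle of the new embedding is a nontrivial knot. The wall between
a shifted edge and the Y consists of parallelograms and triangles, so elementary moves sweep the
edge across it, provided the rest of the knot stays out of the way. A cycle contains zero, one, two
or three edges of the triangle (`cycle_cases`). With none it is a cycle of `G'`. With one, the edge
is swept onto two arms. With `xy` and `yz`, sweeping `yz` onto its arms leaves a finger along the
arm of `y`, which is retracted, and a cycle through the arms of `x` and `z` remains. With three the
knot is trivial. Hence the nontrivial knot is equivalent to a knot of `f`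
(`isTrivialKnot_or_knotEquiv`). -/

lemma carrier_cons_cons (x y : Space) (l : List Space) :
    carrier (x :: y :: l) = segment ℝ x y ∪ carrier (y :: l) := rfl

lemma carrier_pair (x y : Space) : carrier [x, y] = segment ℝ x y := by
  rw [carrier_cons_cons]
  exact Set.union_eq_left.2 (Set.singleton_subset_iff.2 (right_mem_segment ℝ x y))

lemma head_mem_carrier (x : Space) (l : List Space) : x ∈ carrier (x :: l) := by
  cases l with
  | nil => exact rfl
  | cons y l => exact Or.inl (left_mem_segment ℝ x y)

lemma mem_carrier_of_mem {l : List Space} {x : Space} (hx : x ∈ l) : x ∈ carrier l := by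
  induction l with
  | nil => simp at hx
  | cons y l ih =>
    rcases List.mem_cons.1 hx with rfl | h
    · exact head_mem_carrier _ _
    · cases l with
      | nil => simp at h
      | cons z l => exact Or.inr (ih h)

lemma carrier_append_cons (l₁ : List Space) (z : Space) (l₂ : List Space) :
    carrier (l₁ ++ z :: l₂) = carrier (l₁ ++ [z]) ∪ carrier (z :: l₂) := by
  induction l₁ with
  | nil =>
    have := head_mem_carrier z l₂
    ext p
    simp only [List.nil_append, carrier, Set.mem_union, Set.mem_singleton_iff]
    constructor
    · exact Or.inr
    · rintro (rfl | h)
      exacts [this, h]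
  | cons x l ih =>
    cases l with
    | nil =>
      ext p
      have := head_mem_carrier z l₂
      simp only [List.nil_append, List.cons_append, carrier, Set.mem_union, Set.mem_singleton_iff]
      constructor
      · rintro (h | h)
        exacts [Or.inl (Or.inl h), Or.inr h]
      · rintro ((h | rfl) | h)
        exacts [Or.inl h, Or.inr this, Or.inr h]
    | cons y l =>
      simp only [List.cons_append, carrier_cons_cons] at ih ⊢
      rw [ih, Set.union_assoc]

lemma carrier_reverse (l : List Space) : carrier l.reverse = carrier l := by
  induction l with
  | nil => rfl
  | cons x l ih =>
    cases l with
    | nil => rfl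
    | cons y l =>
      rw [carrier_cons_cons, ← ih]
      simp only [List.reverse_cons, List.append_assoc, List.cons_append, List.nil_append]
      rw [carrier_append_cons, Set.union_comm, carrier_pair, segment_symm]

lemma edges_cons_cons (x y : Space) (l : List Space) :
    edges (x :: y :: l) = (x, y) :: edges (y :: l) := rfl

lemma edges_append_cons (l₁ : List Space) (z : Space) (l₂ : List Space) :
    edges (l₁ ++ z :: l₂) = edges (l₁ ++ [z]) ++ edges (z :: l₂) := by
  induction l₁ with
  | nil => rfl
  | cons x l ih =>
    cases l with
    | nil => rfl
    | cons y l =>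
      simp only [List.cons_append, edges_cons_cons] at ih ⊢
      rw [ih]

/-- Two points are required because a one-point path has a nonempty carrier but no edges. -/
lemma mem_carrier_cons_cons {x y : Space} {l : List Space} {z : Space} :
    z ∈ carrier (x :: y :: l) ↔ ∃ e ∈ edges (x :: y :: l), z ∈ segment ℝ e.1 e.2 := by
  induction l generalizing x y with
  | nil =>
    have := right_mem_segment ℝ x y
    simp only [carrier, edges, List.tail_cons, List.zip_cons_cons, List.zip_nil_right,
      List.mem_singleton, exists_eq_left, Set.mem_union, Set.mem_singleton_iff]
    constructor
    · rintro (h | rfl)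
      exacts [h, this]
    · exact Or.inl
  | cons u l ih =>
    rw [carrier_cons_cons, Set.mem_union, ih, edges_cons_cons x y, List.exists_mem_cons_iff]

lemma isSimpleArc_append {l₁ l₂ : List Space} {z : Space} (h₁ : IsSimpleArc (l₁ ++ [z]))
    (h₂ : IsSimpleArc (z :: l₂)) (h : carrier (l₁ ++ [z]) ∩ carrier (z :: l₂) ⊆ {z}) :
    IsSimpleArc (l₁ ++ z :: l₂) := by
  induction l₁ with
  | nil => exact h₂
  | cons x l ih =>
    cases l with
    | nil =>
      simp only [List.nil_append, List.cons_append] at h₁ h ⊢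
      refine ⟨h₁.1, Set.Subset.antisymm ?_ ?_, h₂⟩
      · exact fun p hp => h ⟨Or.inl hp.1, hp.2⟩
      · rintro p rfl
        exact ⟨right_mem_segment ℝ _ _, head_mem_carrier _ _⟩
    | cons y l =>
      simp only [List.cons_append] at h₁ h ih ⊢
      refine ⟨h₁.1, Set.Subset.antisymm ?_ ?_, ih h₁.2.2 fun p hp => h ⟨Or.inr hp.1, hp.2⟩⟩
      · rintro p ⟨hp, hp'⟩
        rw [← h₁.2.1]
        refine ⟨hp, ?_⟩
        rw [← List.cons_append, carrier_append_cons] at hp'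
        rcases hp' with hp' | hp'
        · exact hp'
        · have := h ⟨Or.inl hp, hp'⟩
          rw [Set.mem_singleton_iff.1 this]
          exact mem_carrier_of_mem (by simp)
      · rintro p rfl
        exact ⟨right_mem_segment ℝ _ _, head_mem_carrier _ _⟩

/-! ### Sweeping walls -/

/-- The vector `w` is transverse to `X` and so short that the translates of `X` by the multiples
`t • w` with `|t| ≤ 1` are pairwise disjoint. -/
def Thick (X : Set Space) (w : Space) : Prop :=
  ∀ p ∈ X, ∀ q ∈ X, ∀ t : ℝ, |t| ≤ 2 → p = q + t • w → t = 0

lemma Thick.mono {X Y : Set Space} {w : Space} (h : Thick X w) (hY : Y ⊆ X) : Thick Y w :=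
  fun p hp q hq => h p (hY hp) q (hY hq)

/-- Two heights in [-1, 1] differ by at most 2, which is the bound in `Thick`. Foot point and height
thus serve as coordinates, and most intersection arguments below reduce to this. -/
lemma Thick.eq_and_eq {X : Set Space} {w p q : Space} {s t : ℝ} (h : Thick X w) (hp : p ∈ X)
    (hq : q ∈ X) (hs : |s| ≤ 1) (ht : |t| ≤ 1) (he : p + s • w = q + t • w) : p = q ∧ s = t := by
  have h0 : t - s = 0 := h p hp q hq _ (by rw [abs_le] at *; constructor <;> linarith) (by
    rw [sub_smul, ← add_sub_assoc, ← he]; abel)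
  have hst : s = t := by linarith
  subst hst
  exact ⟨add_right_cancel he, rfl⟩

/-- The union of the translates of `B` by the multiples `t • w` with `0 ≤ t ≤ 1`. -/
def wall (B : Set Space) (w : Space) : Set Space :=
  {z | ∃ p ∈ B, ∃ t : ℝ, 0 ≤ t ∧ t ≤ 1 ∧ z = p + t • w}

lemma wall_mono {B B' : Set Space} (h : B ⊆ B') (w : Space) : wall B w ⊆ wall B' w :=
  fun _ ⟨p, hp, t, h0, h1, hz⟩ => ⟨p, h hp, t, h0, h1, hz⟩

lemma subset_wall (B : Set Space) (w : Space) : B ⊆ wall B w :=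
  fun p hp => ⟨p, hp, 0, le_rfl, zero_le_one, by simp⟩

lemma add_mem_wall {B : Set Space} {p : Space} (hp : p ∈ B) (w : Space) : p + w ∈ wall B w :=
  ⟨p, hp, 1, zero_le_one, le_rfl, by simp⟩

lemma convex_wall {B : Set Space} (hB : Convex ℝ B) (w : Space) : Convex ℝ (wall B w) := by
  rintro _ ⟨p, hp, s, hs, hs', rfl⟩ _ ⟨q, hq, t, ht, ht', rfl⟩ a b ha hb hab
  refine ⟨a • p + b • q, hB hp hq ha hb hab, a * s + b * t, by positivity, by nlinarith, ?_⟩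
  module

lemma Thick.mem_wall {X B : Set Space} {w z : Space} {t : ℝ} (h : Thick X w) (hB : B ⊆ X)
    (hz : z ∈ X) (ht : 0 ≤ t) (ht' : t ≤ 1) (hw : z + t • w ∈ wall B w) : z ∈ B := by
  obtain ⟨p, hp, s, hs, hs', he⟩ := hw
  obtain ⟨rfl, -⟩ := h.eq_and_eq hz (hB hp) (by rwa [abs_of_nonneg ht]) (by rwa [abs_of_nonneg hs])
    he
  exact hp

/-- If `w` were parallel to the segment, a small multiple of it would carry an inner point to
another point of the same segment. -/
lemma Thick.linearIndependent {p q w : Space} (h : Thick (segment ℝ p q) w) (hpq : p ≠ q) :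
    ∀ s t : ℝ, s • (q - p) + t • w = 0 → s = 0 ∧ t = 0 := by
  intro s t hst
  have ht : t = 0 := by
    by_contra ht
    have hw : w = (-(s / t)) • (q - p) := by
      have : t • w = (-s) • (q - p) := by
        rw [neg_smul]; exact eq_neg_of_add_eq_zero_right hst
      rw [← inv_smul_smul₀ ht w, this, smul_smul]; congr 1; field_simp
    set c := -(s / t)
    have hc : 0 < 1 + |c| := by positivity
    -- Chosen so that `k ≤ 1` and `|k * c| ≤ 1 / 2`: moving the midpoint by `k • w` then stays on
    -- the segment.
    set k := (1 / (2 * (1 + |c|)))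
    have hk : 0 < k := by positivity
    have hk1 : k ≤ 1 := by
      rw [div_le_one (by positivity)]; nlinarith [abs_nonneg c]
    have hkc : |k * c| ≤ 1 / 2 := by
      rw [abs_mul, abs_of_pos hk, div_mul_eq_mul_div, div_le_div_iff₀ (by positivity) (by positivity)]
      nlinarith [abs_nonneg c]
    have := h (p + (1 / 2 + k * c) • (q - p)) ?_ (p + (1 / 2 : ℝ) • (q - p)) ?_ k ?_ ?_
    · exact hk.ne' this
    · rw [segment_eq_image']
      refine ⟨_, ?_, rfl⟩
      rw [abs_le] at hkc
      constructor <;> linarith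
    · rw [segment_eq_image']
      exact ⟨_, by norm_num, rfl⟩
    · rw [abs_of_pos hk]; linarith
    · rw [hw]; module
  subst ht
  refine ⟨?_, rfl⟩
  rw [zero_smul, add_zero, smul_eq_zero] at hst
  exact hst.resolve_right (sub_ne_zero.2 hpq.symm)

lemma affineIndependent_of_pair {p q r : Space}
    (h : ∀ s t : ℝ, s • (q - p) + t • (r - p) = 0 → s = 0 ∧ t = 0) :
    AffineIndependent ℝ ![p, q, r] := by
  rw [affineIndependent_iff_linearIndependent_vsub ℝ _ (0 : Fin 3),
    ← linearIndependent_equiv (finSuccAboveEquiv (0 : Fin 3))]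
  convert (LinearIndependent.pair_iff (R := ℝ) (x := q - p) (y := r - p)).2 h using 1
  ext i
  fin_cases i <;> rfl

lemma KnotEquiv.refl (K : Set Space) : KnotEquiv K K := Relation.EqvGen.refl K
lemma KnotEquiv.symm {K K' : Set Space} (h : KnotEquiv K K') : KnotEquiv K' K :=
  Relation.EqvGen.symm _ _ h
lemma KnotEquiv.trans {K K' K'' : Set Space} (h : KnotEquiv K K') (h' : KnotEquiv K' K'') :
    KnotEquiv K K'' := Relation.EqvGen.trans _ _ _ h h'

lemma IsTrivialKnot.of_equiv {K K' : Set Space} (h : KnotEquiv K K') (h' : IsTrivialKnot K') :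
    IsTrivialKnot K := by
  obtain ⟨p, q, r, hi, he⟩ := h'
  exact ⟨p, q, r, hi, h.trans he⟩

/-- An elementary move with the rest `R` of the knot as a separate set. Since `R` meets the triangle
at most in `p` and `q`, it avoids the open segment that is removed, and the two ends reappear in the
new sides. In this form moves can be chained by enlarging `R`. -/
lemma knotEquiv_triangle {R : Set Space} {p q r : Space} (h : AffineIndependent ℝ ![p, q, r])
    (hR : R ∩ convexHull ℝ {p, q, r} ⊆ {p, q}) :
    KnotEquiv (R ∪ segment ℝ p q) (R ∪ (segment ℝ p r ∪ segment ℝ r q)) := by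
  have hpq : p ≠ q := fun he => by
    have := h.injective.ne (show (0 : Fin 3) ≠ 1 by decide)
    exact this (by simpa using he)
  have hsub : segment ℝ p q ⊆ convexHull ℝ {p, q, r} :=
    segment_subset_convexHull (by simp) (by simp)
  have hp : p ∉ openSegment ℝ p q := by
    rw [left_mem_openSegment_iff]; exact hpq
  have hq : q ∉ openSegment ℝ p q := by
    rw [right_mem_openSegment_iff]; exact hpq
  refine Relation.EqvGen.rel _ _ ⟨p, q, r, h, ?_, ?_⟩
  · refine Set.Subset.antisymm ?_ fun z hz => ⟨hsub hz, Or.inr hz⟩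
    rintro z ⟨hz, hz' | hz'⟩
    · rcases hR ⟨hz', hz⟩ with rfl | rfl
      exacts [left_mem_segment ℝ _ _, right_mem_segment ℝ _ _]
    · exact hz'
  · have := insert_endpoints_openSegment ℝ p q
    have hpr := left_mem_segment ℝ p r
    have hrq := right_mem_segment ℝ r q
    ext z
    constructor
    · rintro (hz | hz)
      · refine Or.inl ⟨Or.inl hz, fun ho => ?_⟩
        rcases hR ⟨hz, hsub (openSegment_subset_segment ℝ _ _ ho)⟩ with rfl | rfl
        exacts [hp ho, hq ho]
      · exact Or.inr hz
    · rintro (⟨hz | hz, ho⟩ | hz)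
      · exact Or.inl hz
      · rw [← this] at hz
        rcases hz with rfl | rfl | hz
        exacts [Or.inr (Or.inl hpr), Or.inr (Or.inr hrq), absurd hz ho]
      · exact Or.inr hz

/-- Translate all points of a list except the last one. -/
def lift (w : Space) : List Space → List Space
  | [] => []
  | [x] => [x]
  | x :: y :: l => (x + w) :: lift w (y :: l)

lemma lift_concat (w : Space) (l : List Space) (x : Space) :
    lift w (l ++ [x]) = l.map (· + w) ++ [x] := by
  induction l with
  | nil => rfl
  | cons y l ih =>
    cases l with
    | nil => rfl
    | cons z l =>
      simp only [List.cons_append, List.map_cons] at ih ⊢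
      rw [lift, ih]

end KnotLink

namespace KnotLink

/-! ### Triangle and parallelogram moves inside a wall -/

lemma KnotEquiv.congr {A A' B B' : Set Space} (h : KnotEquiv A B) (hA : A' = A) (hB : B' = B) :
    KnotEquiv A' B' := by
  rw [hA, hB]; exact h

lemma left_mem_wall (p q w : Space) : p ∈ wall (segment ℝ p q) w :=
  subset_wall _ _ (left_mem_segment ℝ p q)

lemma right_mem_wall (p q w : Space) : q ∈ wall (segment ℝ p q) w :=
  subset_wall _ _ (right_mem_segment ℝ p q)

lemma left_add_mem_wall (p q w : Space) : p + w ∈ wall (segment ℝ p q) w :=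
  add_mem_wall (left_mem_segment ℝ p q) w

lemma right_add_mem_wall (p q w : Space) : q + w ∈ wall (segment ℝ p q) w :=
  add_mem_wall (right_mem_segment ℝ p q) w

/-- The wall over a segment is convex and so contains the triangle; it suffices to keep `R` out of
the wall. -/
lemma knotEquiv_triangle_of_wall {R : Set Space} {a b c p q w : Space}
    (h : ∀ s t : ℝ, s • (b - a) + t • (c - a) = 0 → s = 0 ∧ t = 0)
    (ha : a ∈ wall (segment ℝ p q) w) (hb : b ∈ wall (segment ℝ p q) w)
    (hc : c ∈ wall (segment ℝ p q) w) (hR : R ∩ wall (segment ℝ p q) w ⊆ {a, b}) :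
    KnotEquiv (R ∪ segment ℝ a b) (R ∪ (segment ℝ a c ∪ segment ℝ c b)) := by
  refine knotEquiv_triangle (affineIndependent_of_pair h) fun z hz => hR ⟨hz.1, ?_⟩
  refine convexHull_min ?_ (convex_wall (convex_segment p q) w) hz.2
  rintro x (rfl | rfl | rfl) <;> assumption

section
variable {R : Set Space} {p q w : Space}

/-- Sweeping a parallelogram from two of its sides to the other two. -/
lemma knotEquiv_parallelogram (hT : Thick (segment ℝ p q) w) (hpq : p ≠ q)
    (hR : R ∩ wall (segment ℝ p q) w ⊆ {p, q + w}) :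
    KnotEquiv (R ∪ (segment ℝ p (p + w) ∪ segment ℝ (p + w) (q + w)))
      (R ∪ (segment ℝ p q ∪ segment ℝ q (q + w))) := by
  have hli := hT.linearIndependent hpq
  -- Both pairs of sides are compared with the diagonal from `p` to `q + w`.
  refine (knotEquiv_triangle_of_wall (p := p) (q := q) (w := w) (c := p + w) ?_ (left_mem_wall _ _ _)
    (right_add_mem_wall _ _ _) (left_add_mem_wall _ _ _) hR).symm.trans
    (knotEquiv_triangle_of_wall (p := p) (q := q) (w := w) ?_ (left_mem_wall _ _ _)
    (right_add_mem_wall _ _ _) (right_mem_wall _ _ _) hR)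
  · intro s t h
    have := hli s (s + t) (by rw [← h]; module)
    constructor <;> linarith [this.1, this.2]
  · intro s t h
    have := hli (s + t) s (by rw [← h]; module)
    constructor <;> linarith [this.1, this.2]

lemma mem_half_parallelogram {z : Space} (hz : z ∈ convexHull ℝ {q, p + w, q + w}) :
    ∃ s t : ℝ, 1 ≤ s + t ∧ s ≤ 1 ∧ t ≤ 1 ∧ z = p + s • (q - p) + t • w := by
  have : Convex ℝ {z : Space | ∃ s t : ℝ, 1 ≤ s + t ∧ s ≤ 1 ∧ t ≤ 1 ∧
      z = p + s • (q - p) + t • w} := by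
    rintro _ ⟨s, t, h1, h2, h3, rfl⟩ _ ⟨s', t', h1', h2', h3', rfl⟩ a b ha hb hab
    refine ⟨a * s + b * s', a * t + b * t', by nlinarith, by nlinarith, by nlinarith, ?_⟩
    obtain rfl : b = 1 - a := by linarith
    module
  refine convexHull_min ?_ this hz
  rintro x (rfl | rfl | rfl)
  · exact ⟨1, 0, by norm_num, by norm_num, by norm_num, by module⟩
  · exact ⟨0, 1, by norm_num, by norm_num, by norm_num, by module⟩
  · exact ⟨1, 1, by norm_num, by norm_num, by norm_num, by module⟩

lemma mem_lower_half_parallelogram {z : Space} (hz : z ∈ convexHull ℝ {p, q + w, q}) :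
    ∃ s t : ℝ, 0 ≤ t ∧ t ≤ s ∧ s ≤ 1 ∧ z = p + s • (q - p) + t • w := by
  have : Convex ℝ {z : Space | ∃ s t : ℝ, 0 ≤ t ∧ t ≤ s ∧ s ≤ 1 ∧
      z = p + s • (q - p) + t • w} := by
    rintro _ ⟨s, t, h1, h2, h3, rfl⟩ _ ⟨s', t', h1', h2', h3', rfl⟩ a b ha hb hab
    refine ⟨a * s + b * s', a * t + b * t', by positivity, by nlinarith, by nlinarith, ?_⟩
    obtain rfl : b = 1 - a := by linarith
    module
  refine convexHull_min ?_ this hz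
  rintro x (rfl | rfl | rfl)
  · exact ⟨0, 0, by norm_num, by norm_num, by norm_num, by module⟩
  · exact ⟨1, 1, by norm_num, by norm_num, by norm_num, by module⟩
  · exact ⟨1, 0, by norm_num, by norm_num, by norm_num, by module⟩

/-- Sweeping a parallelogram from one of its sides to the other three. -/
lemma knotEquiv_parallelogram_side (hT : Thick (segment ℝ p q) w) (hpq : p ≠ q)
    (hR : R ∩ wall (segment ℝ p q) w ⊆ {p, p + w}) :
    KnotEquiv (R ∪ segment ℝ p (p + w))
      (R ∪ (segment ℝ p q ∪ segment ℝ q (q + w) ∪ segment ℝ (p + w) (q + w))) := by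
  have hli := hT.linearIndependent hpq
  -- The side is first pushed over the triangle with third vertex `q`; its new side from `q` to `p +
  -- w` is then pushed over the other half. In that second move the side `pq` already belongs to the
  -- rest of the knot.
  have h1 := knotEquiv_triangle_of_wall (p := p) (q := q) (w := w) (c := q) (R := R) (a := p)
    (b := p + w) ?_ (left_mem_wall _ _ _) (left_add_mem_wall _ _ _) (right_mem_wall _ _ _) hR
  · have h2 := knotEquiv_triangle (R := R ∪ segment ℝ p q) (p := q) (q := p + w) (r := q + w)
      (affineIndependent_of_pair ?_) ?_
    · refine (h1.congr rfl ?_).trans (h2.congr rfl ?_)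
      · rw [Set.union_assoc]
      · rw [segment_symm ℝ (p + w) (q + w)]
        ext z; simp only [Set.mem_union]; tauto
    · intro s t h
      have := hli (-s) (s + t) (by rw [← h]; module)
      constructor <;> linarith [this.1, this.2]
    · rintro z ⟨hz, hz'⟩
      obtain ⟨s, t, hst, hs, ht, he⟩ := mem_half_parallelogram hz'
      rcases hz with hz | hz
      · have hsub : ({q, p + w, q + w} : Set Space) ⊆ wall (segment ℝ p q) w := by
          rintro x (rfl | rfl | rfl)
          exacts [right_mem_wall _ _ _, left_add_mem_wall _ _ _, right_add_mem_wall _ _ _]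
        rcases hR ⟨hz, convexHull_min hsub (convex_wall (convex_segment p q) w) hz'⟩ with rfl | rfl
        -- The point `p` has coordinates `s = t = 0`, which `1 ≤ s + t` excludes from the upper
        -- half.
        · exfalso
          have := hli s t (by
            have : s • (q - z) + t • w = z + s • (q - z) + t • w - z := by abel
            rw [this, ← he, sub_self])
          linarith
        · exact Or.inr rfl
      · rw [segment_eq_image'] at hz
        obtain ⟨r, ⟨hr, hr'⟩, rfl⟩ := hz
        have := hli (r - s) (-t) (by
          have : (r - s) • (q - p) + (-t) • w
            = (p + r • (q - p)) - (p + s • (q - p) + t • w) := by module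
          rw [this, ← he, sub_self])
        left
        have : r = 1 := by linarith [this.1, this.2]
        subst this
        simp
  · intro s t h
    have := hli t s (by rw [← h]; module)
    exact ⟨this.2, this.1⟩

end

/-- The lifted path has height 1 up to its last edge and descends linearly to 0 along it, so height
0 occurs only at the last point. -/
lemma lift_mem {w : Space} {l : List Space} {z : Space} (hz : z ∈ carrier (lift w l)) :
    ∃ p ∈ carrier l, ∃ t : ℝ, 0 ≤ t ∧ t ≤ 1 ∧ z = p + t • w ∧ (t = 0 → l.getLast? = some p) := by
  induction l with
  | nil => exact hz.elim
  | cons q l ih =>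
    cases l with
    | nil =>
      obtain rfl : z = q := hz
      exact ⟨z, rfl, 0, le_rfl, zero_le_one, by simp, by simp⟩
    | cons x l =>
      cases l with
      | nil =>
        rw [show lift w [q, x] = [q + w, x] from rfl, carrier_pair, segment_eq_image'] at hz
        obtain ⟨s, ⟨hs, hs'⟩, rfl⟩ := hz
        refine ⟨q + s • (x - q), ?_, 1 - s, by linarith, by linarith, by module, ?_⟩
        · rw [carrier_pair, segment_eq_image']
          exact ⟨s, ⟨hs, hs'⟩, rfl⟩
        · intro h
          obtain rfl : s = 1 := by linarith
          simp
      | cons y l =>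
        rcases hz with hz | hz
        · rw [segment_eq_image'] at hz
          obtain ⟨s, ⟨hs, hs'⟩, rfl⟩ := hz
          refine ⟨q + s • (x - q), ?_, 1, zero_le_one, le_rfl, by module, by simp⟩
          left
          rw [segment_eq_image']
          exact ⟨s, ⟨hs, hs'⟩, rfl⟩
        · obtain ⟨p, hp, t, h0, h1, h2, h3⟩ := ih hz
          exact ⟨p, Or.inr hp, t, h0, h1, h2, by simpa using h3⟩

lemma carrier_lift_subset (w : Space) (l : List Space) :
    carrier (lift w l) ⊆ wall (carrier l) w := fun z hz => by
  obtain ⟨p, hp, t, h0, h1, h2, -⟩ := lift_mem hz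
  exact ⟨p, hp, t, h0, h1, h2⟩

lemma IsSimpleArc.head_notMem {p q : Space} {l : List Space} (h : IsSimpleArc (p :: q :: l)) :
    p ∉ carrier (q :: l) := fun hp => by
  have : p ∈ ({q} : Set Space) := by
    rw [← h.2.1]
    exact ⟨left_mem_segment ℝ p q, hp⟩
  exact h.1 this

/-- Above its first point, a lifted path has height one. -/
lemma eq_of_mem_lift {p q w : Space} {l : List Space} (h : IsSimpleArc (p :: q :: l))
    (hT : Thick (carrier (p :: q :: l)) w) {t : ℝ} (h0 : 0 ≤ t) (h1 : t ≤ 1)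
    (hz : p + t • w ∈ carrier (lift w (p :: q :: l))) : p + t • w = p + w := by
  have ht : |t| ≤ 1 := by rwa [abs_of_nonneg h0]
  -- Here `s` is the position along the first edge and `r` the height there. Thickness forces the
  -- foot point to be `p`, hence `s = 0`, where the height is 1.
  have key : ∀ s r : ℝ, 0 ≤ s → s ≤ 1 → 0 ≤ r → r ≤ 1 → (s = 0 → r = 1) →
      p + t • w = (p + s • (q - p)) + r • w → p + t • w = p + w := by
    intro s r hs hs' hr hr' hsr he
    have := hT.eq_and_eq (head_mem_carrier _ _) (q := p + s • (q - p)) (Or.inl (by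
      rw [segment_eq_image']
      exact ⟨s, ⟨hs, hs'⟩, rfl⟩)) ht (by rwa [abs_of_nonneg hr]) he
    have h3 : s • (q - p) = 0 := by simpa using this.1
    have : s = 0 := (smul_eq_zero.1 h3).resolve_right (sub_ne_zero.2 h.1.symm)
    rw [this, hsr this] at he
    simpa using he
  have htail : p + t • w ∈ wall (carrier (q :: l)) w → False := fun hw =>
    h.head_notMem (hT.mem_wall (fun x hx => Or.inr hx) (head_mem_carrier _ _) h0 h1 hw)
  cases l with
  | nil =>
    rw [show lift w [p, q] = [p + w, q] from rfl, carrier_pair, segment_eq_image'] at hz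
    obtain ⟨s, ⟨hs, hs'⟩, he⟩ := hz
    exact key s (1 - s) hs hs' (by linarith) (by linarith) (by intro h; linarith)
      (by rw [← he]; module)
  | cons y l =>
    rcases hz with hz | hz
    · rw [segment_eq_image'] at hz
      obtain ⟨s, ⟨hs, hs'⟩, he⟩ := hz
      exact key s 1 hs hs' zero_le_one le_rfl (fun _ => rfl) (by rw [← he]; module)
    · exact (htail (carrier_lift_subset w _ hz)).elim

/-- The wall over the first edge of a path meets the wall over the rest of the path in the common
vertical edge. -/
lemma Thick.wall_inter {p q w z : Space} {l : List Space} (h : IsSimpleArc (p :: q :: l))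
    (hT : Thick (carrier (p :: q :: l)) w) (hz : z ∈ wall (segment ℝ p q) w)
    (hz' : z ∈ wall (carrier (q :: l)) w) : ∃ t : ℝ, 0 ≤ t ∧ t ≤ 1 ∧ z = q + t • w := by
  obtain ⟨x, hx, t, h0, h1, rfl⟩ := hz
  have := hT.mem_wall (fun x hx => Or.inr hx) (Or.inl hx) h0 h1 hz'
  have hxq : x ∈ ({q} : Set Space) := by
    rw [← h.2.1]; exact ⟨hx, this⟩
  rw [Set.mem_singleton_iff.1 hxq]
  exact ⟨t, h0, h1, rfl⟩

lemma carrier_lift_cons_cons_cons (w p q y : Space) (l : List Space) :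
    carrier (lift w (p :: q :: y :: l))
      = segment ℝ (p + w) (q + w) ∪ carrier (lift w (q :: y :: l)) := rfl

lemma carrier_lift_pair (w p q : Space) : carrier (lift w [p, q]) = segment ℝ (p + w) q :=
  carrier_pair _ _

lemma getLast?_mem_carrier {l : List Space} {x : Space} (h : l.getLast? = some x) :
    x ∈ carrier l := mem_carrier_of_mem (List.mem_of_getLast? h)

section
variable {R : Set Space} {p q x w z : Space} {l : List Space}

/-- This and the following lemmas supply the disjointness conditions for the inductions along a
path: parts of the knot on one side of the vertical line over `q` meet the wall on the other side at
most at `q` or `q + w`. -/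
lemma Thick.eq_of_mem_carrier (h : IsSimpleArc (p :: q :: l))
    (hT : Thick (carrier (p :: q :: l)) w) (hz : z ∈ carrier (q :: l))
    (hz' : z ∈ wall (segment ℝ p q) w) : z = q := by
  obtain ⟨t, h0, h1, he⟩ := hT.wall_inter h hz' (subset_wall _ _ hz)
  have := hT z (Or.inr hz) q (Or.inr (head_mem_carrier _ _)) t
    (by rw [abs_of_nonneg h0]; linarith) he
  subst this
  simpa using he

lemma Thick.eq_of_mem_lift {y : Space} (h : IsSimpleArc (p :: q :: y :: l))
    (hT : Thick (carrier (p :: q :: y :: l)) w) (hz : z ∈ carrier (lift w (q :: y :: l)))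
    (hz' : z ∈ wall (segment ℝ p q) w) : z = q + w := by
  obtain ⟨t, h0, h1, rfl⟩ := hT.wall_inter h hz' (carrier_lift_subset _ _ hz)
  exact KnotLink.eq_of_mem_lift h.2.2 (hT.mono fun _ hx => Or.inr hx) h0 h1 hz

lemma Thick.eq_of_mem_segment_add (h : IsSimpleArc (p :: q :: l))
    (hT : Thick (carrier (p :: q :: l)) w) {t : ℝ} (h0 : 0 ≤ t) (h1 : t ≤ 1)
    (hz : z ∈ segment ℝ (p + t • w) (q + t • w)) (hz' : z ∈ wall (carrier (q :: l)) w) :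
    z = q + t • w := by
  rw [segment_eq_image'] at hz
  obtain ⟨s, hs, rfl⟩ := hz
  have hm : p + s • (q - p) ∈ segment ℝ p q := by
    rw [segment_eq_image']; exact ⟨s, hs, rfl⟩
  have he : p + t • w + s • (q + t • w - (p + t • w)) = p + s • (q - p) + t • w := by module
  simp only [he] at hz' ⊢
  have := hT.mem_wall (fun x hx => Or.inr hx) (Or.inl hm) h0 h1 hz'
  have h5 : p + s • (q - p) ∈ ({q} : Set Space) := by
    rw [← h.2.1]; exact ⟨hm, this⟩
  rw [Set.mem_singleton_iff.1 h5]

lemma Thick.eq_of_mem_segment (h : IsSimpleArc (p :: q :: l))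
    (hT : Thick (carrier (p :: q :: l)) w) (hz : z ∈ segment ℝ p q)
    (hz' : z ∈ wall (carrier (q :: l)) w) : z = q := by
  simpa using hT.eq_of_mem_segment_add h le_rfl zero_le_one (by simpa using hz) hz'

lemma Thick.eq_of_mem_segment_top (h : IsSimpleArc (p :: q :: l))
    (hT : Thick (carrier (p :: q :: l)) w) (hz : z ∈ segment ℝ (p + w) (q + w))
    (hz' : z ∈ wall (carrier (q :: l)) w) : z = q + w := by
  simpa using hT.eq_of_mem_segment_add h zero_le_one le_rfl (by simpa using hz) hz'

lemma Thick.add_notMem_wall (h : IsSimpleArc (p :: q :: l))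
    (hT : Thick (carrier (p :: q :: l)) w) : p + w ∉ wall (carrier (q :: l)) w := fun hp =>
  h.head_notMem (hT.mem_wall (t := 1) (fun x hx => Or.inr hx) (head_mem_carrier _ _)
    zero_le_one le_rfl (by rwa [one_smul]))

lemma Thick.notMem_wall (h : IsSimpleArc (p :: q :: l))
    (hT : Thick (carrier (p :: q :: l)) w) : p ∉ wall (carrier (q :: l)) w := fun hp =>
  h.head_notMem (hT.mem_wall (t := 0) (fun x hx => Or.inr hx) (head_mem_carrier _ _)
    le_rfl zero_le_one (by simpa using hp))

/-- Sweeping the wall over a path from its upper edge to the other edges. -/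
lemma knotEquiv_lift_lower (h : IsSimpleArc (p :: q :: l)) (hT : Thick (carrier (p :: q :: l)) w)
    (hx : (p :: q :: l).getLast? = some x)
    (hR : R ∩ wall (carrier (p :: q :: l)) w ⊆ {p + w, x}) :
    KnotEquiv (R ∪ carrier (lift w (p :: q :: l)))
      (R ∪ (carrier (p :: q :: l) ∪ segment ℝ p (p + w))) := by
  induction l generalizing R p q with
  | nil =>
    obtain rfl : q = x := by simpa using hx
    rw [carrier_pair] at *
    have hli := hT.linearIndependent h.1
    rw [carrier_lift_pair]
    refine (knotEquiv_triangle_of_wall (c := p) ?_ (left_add_mem_wall _ _ _) (right_mem_wall _ _ _)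
      (left_mem_wall _ _ _) hR).congr rfl ?_
    · intro s t h
      have := hli s (-s - t) (by rw [← h]; module)
      constructor <;> linarith [this.1, this.2]
    · rw [segment_symm ℝ p (p + w), Set.union_comm (segment ℝ p q)]
  | cons y l ih =>
    have hTs : Thick (segment ℝ p q) w := hT.mono fun _ hx => Or.inl hx
    have hTl : Thick (carrier (q :: y :: l)) w := hT.mono fun _ hx => Or.inr hx
    have hx' : (q :: y :: l).getLast? = some x := by simpa using hx
    -- The wall over the tail is swept first and leaves the vertical segment at `q`; the first
    -- parallelogram then carries this segment and the top edge to `pq` and the vertical segment at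
    -- `p`.
    have h1 := ih (R := R ∪ segment ℝ (p + w) (q + w)) h.2.2 hTl hx' ?_
    · have h2 := knotEquiv_parallelogram (R := R ∪ carrier (q :: y :: l)) (p := q) (q := p) (w := w)
        (by rwa [segment_symm]) h.1.symm ?_
      · refine (h1.congr ?_ rfl).trans (h2.congr ?_ ?_)
        · rw [carrier_lift_cons_cons_cons, Set.union_assoc]
        · rw [segment_symm ℝ (q + w)]; ext z; simp only [Set.mem_union]; tauto
        · rw [carrier_cons_cons p, segment_symm ℝ q p]; ext z; simp only [Set.mem_union]; tauto
      · rw [segment_symm]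
        rintro z ⟨hz | hz, hz'⟩
        · rcases hR ⟨hz, wall_mono (fun _ hx => Or.inl hx) _ hz'⟩ with rfl | rfl
          · exact Or.inr rfl
          · exact Or.inl (hT.eq_of_mem_carrier h (getLast?_mem_carrier hx') hz')
        · exact Or.inl (hT.eq_of_mem_carrier h hz hz')
    · rintro z ⟨hz | hz, hz'⟩
      · rcases hR ⟨hz, wall_mono (fun _ hx => Or.inr hx) _ hz'⟩ with rfl | rfl
        · exact absurd hz' (hT.add_notMem_wall h)
        · exact Or.inr rfl
      · exact Or.inl (hT.eq_of_mem_segment_top h hz hz')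

/-- Sweeping the wall over a path from its upper edge and its first vertical edge to its lower
edge. -/
lemma knotEquiv_lift_lower_foot (h : IsSimpleArc (p :: q :: l))
    (hT : Thick (carrier (p :: q :: l)) w) (hx : (p :: q :: l).getLast? = some x)
    (hR : R ∩ wall (carrier (p :: q :: l)) w ⊆ {p, x}) :
    KnotEquiv (R ∪ (carrier (lift w (p :: q :: l)) ∪ segment ℝ p (p + w)))
      (R ∪ carrier (p :: q :: l)) := by
  induction l generalizing R p q with
  | nil =>
    obtain rfl : q = x := by simpa using hx
    rw [carrier_pair] at *
    have hli := hT.linearIndependent h.1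
    rw [carrier_lift_pair]
    refine (knotEquiv_triangle_of_wall (c := p + w) ?_ (left_mem_wall _ _ _) (right_mem_wall _ _ _)
      (left_add_mem_wall _ _ _) hR).symm.congr ?_ rfl
    · intro s t h
      have := hli s t (by rw [← h]; module)
      constructor <;> linarith [this.1, this.2]
    · rw [Set.union_comm (segment ℝ p _)]
  | cons y l ih =>
    have hTs : Thick (segment ℝ p q) w := hT.mono fun _ hx => Or.inl hx
    have hTl : Thick (carrier (q :: y :: l)) w := hT.mono fun _ hx => Or.inr hx
    have hx' : (q :: y :: l).getLast? = some x := by simpa using hx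
    -- With a foot at `p` the order is reversed: the first parallelogram is swept first, and this
    -- moves the foot to `q`, where the induction hypothesis takes over.
    have h1 := ih (R := R ∪ segment ℝ p q) h.2.2 hTl hx' ?_
    · have h2 := knotEquiv_parallelogram (R := R ∪ carrier (lift w (q :: y :: l))) (p := p) (q := q)
        (w := w) hTs h.1 ?_
      · refine (h2.congr ?_ rfl).trans (h1.congr ?_ ?_)
        · rw [carrier_lift_cons_cons_cons]; ext z; simp only [Set.mem_union]; tauto
        · ext z; simp only [Set.mem_union]; tauto
        · rw [carrier_cons_cons p, Set.union_assoc]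
      · rintro z ⟨hz | hz, hz'⟩
        · rcases hR ⟨hz, wall_mono (fun _ hx => Or.inl hx) _ hz'⟩ with rfl | rfl
          · exact Or.inl rfl
          · exfalso
            obtain rfl := hT.eq_of_mem_carrier h (getLast?_mem_carrier hx') hz'
            exact h.2.2.head_notMem (getLast?_mem_carrier (by simpa using hx'))
        · exact Or.inr (hT.eq_of_mem_lift h hz hz')
    · rintro z ⟨hz | hz, hz'⟩
      · rcases hR ⟨hz, wall_mono (fun _ hx => Or.inr hx) _ hz'⟩ with rfl | rfl
        · exact absurd hz' (hT.notMem_wall h)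
        · exact Or.inr rfl
      · exact Or.inl (hT.eq_of_mem_segment h hz hz')

/-- Sweeping the wall over a path from its upper and lower edges to its first vertical edge. -/
lemma knotEquiv_collapse (h : IsSimpleArc (p :: q :: l))
    (hT : Thick (carrier (p :: q :: l)) w)
    (hR : R ∩ wall (carrier (p :: q :: l)) w ⊆ {p, p + w}) :
    KnotEquiv (R ∪ (carrier (lift w (p :: q :: l)) ∪ carrier (p :: q :: l)))
      (R ∪ segment ℝ p (p + w)) := by
  induction l generalizing R p q with
  | nil =>
    rw [carrier_pair] at *
    have hli := hT.linearIndependent h.1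
    rw [carrier_lift_pair]
    refine (knotEquiv_triangle_of_wall (c := q) ?_ (left_mem_wall _ _ _) (left_add_mem_wall _ _ _)
      (right_mem_wall _ _ _) hR).symm.congr ?_ rfl
    · intro s t h
      have := hli t s (by rw [← h]; module)
      constructor <;> linarith [this.1, this.2]
    · rw [Set.union_comm (segment ℝ p _), segment_symm ℝ q]
  | cons y l ih =>
    have hTs : Thick (segment ℝ p q) w := hT.mono fun _ hx => Or.inl hx
    have hTl : Thick (carrier (q :: y :: l)) w := hT.mono fun _ hx => Or.inr hx
    -- The wall over the tail collapses to the vertical segment at `q`, and the first parallelogram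
    -- is then retracted onto its side at `p`.
    have h1 := ih (R := R ∪ (segment ℝ p q ∪ segment ℝ (p + w) (q + w))) h.2.2 hTl ?_
    · have h2 := (knotEquiv_parallelogram_side (R := R) hTs h.1
        fun z hz => hR ⟨hz.1, wall_mono (fun _ hx => Or.inl hx) _ hz.2⟩).symm
      refine (h1.congr ?_ rfl).trans (h2.congr ?_ rfl)
      · rw [carrier_lift_cons_cons_cons, carrier_cons_cons p]
        ext z; simp only [Set.mem_union]; tauto
      · ext z; simp only [Set.mem_union]; tauto
    · rintro z ⟨hz | hz | hz, hz'⟩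
      · rcases hR ⟨hz, wall_mono (fun _ hx => Or.inr hx) _ hz'⟩ with rfl | rfl
        · exact absurd hz' (hT.notMem_wall h)
        · exact absurd hz' (hT.add_notMem_wall h)
      · exact Or.inl (hT.eq_of_mem_segment h hz hz')
      · exact Or.inr (hT.eq_of_mem_segment_top h hz hz')

/-- The boundary of the wall over a path is a trivial knot. -/
lemma isTrivialKnot_boundary (h : IsSimpleArc (p :: q :: l))
    (hT : Thick (carrier (p :: q :: l)) w) :
    IsTrivialKnot (segment ℝ p (p + w) ∪ (carrier (lift w (p :: q :: l)) ∪ carrier (p :: q :: l))) := by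
  have hTs : Thick (segment ℝ p q) w := hT.mono fun z hz => by
    cases l with
    | nil => rwa [carrier_pair]
    | cons y l => exact Or.inl hz
  have hli := hTs.linearIndependent h.1
  cases l with
  | nil =>
    refine ⟨p, p + w, q, affineIndependent_of_pair fun s t h => ?_, ?_⟩
    · have := hli t s (by rw [← h]; module)
      constructor <;> linarith [this.1, this.2]
    · rw [carrier_pair, carrier_lift_pair, segment_symm ℝ q p]
      exact .refl _
  | cons y l =>
    have hTl : Thick (carrier (q :: y :: l)) w := hT.mono fun _ hx => Or.inr hx
    -- All of the wall except the first parallelogram is retracted; cutting the corner `q` off that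
    -- parallelogram leaves a triangle.
    have h1 := knotEquiv_collapse (R := segment ℝ p (p + w) ∪ (segment ℝ p q
      ∪ segment ℝ (p + w) (q + w))) h.2.2 hTl ?_
    · refine ⟨p, p + w, q + w, affineIndependent_of_pair fun s t h => ?_, ?_⟩
      · have := hli t (s + t) (by rw [← h]; module)
        constructor <;> linarith [this.1, this.2]
      · have h2 := knotEquiv_triangle (p := p) (q := q + w) (r := q)
          (R := segment ℝ p (p + w) ∪ segment ℝ (p + w) (q + w)) ?_ ?_
        · refine (h1.congr ?_ rfl).trans (h2.symm.congr ?_ ?_)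
          · rw [carrier_lift_cons_cons_cons, carrier_cons_cons p]
            ext z; simp only [Set.mem_union]; tauto
          · ext z; simp only [Set.mem_union]; tauto
          · rw [segment_symm ℝ (q + w) p]
            ext z; simp only [Set.mem_union]; tauto
        · refine affineIndependent_of_pair fun s t h => ?_
          have := hli (s + t) s (by rw [← h]; module)
          constructor <;> linarith [this.1, this.2]
        · rintro z ⟨hz, hz'⟩
          obtain ⟨s, t, ht0, hts, hs1, rfl⟩ := mem_lower_half_parallelogram hz'
          rcases hz with hz | hz
          · rw [segment_eq_image'] at hz
            obtain ⟨r, -, hr⟩ := hz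
            have := hli s (t - r) (by
              have : s • (q - p) + (t - r) • w = (p + s • (q - p) + t • w)
                - (p + r • (p + w - p)) := by module
              rw [this, ← hr, sub_self])
            obtain rfl : t = 0 := by linarith
            left
            rw [this.1]; simp
          · rw [segment_eq_image'] at hz
            obtain ⟨r, -, hr⟩ := hz
            have := hli (s - r) (t - 1) (by
              have : (s - r) • (q - p) + (t - 1) • w = (p + s • (q - p) + t • w)
                - (p + w + r • (q + w - (p + w))) := by module
              rw [this, ← hr, sub_self])
            obtain rfl : t = 1 := by linarith
            obtain rfl : s = 1 := by linarith
            right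
            show _ = _
            module
    · rintro z ⟨hz | hz | hz, hz'⟩
      · rw [segment_eq_image'] at hz
        obtain ⟨r, hr, rfl⟩ := hz
        rw [add_sub_cancel_left] at hz'
        exact absurd (hT.mem_wall (fun x hx => Or.inr hx) (head_mem_carrier _ _) hr.1 hr.2 hz')
          h.head_notMem
      · exact Or.inl (hT.eq_of_mem_segment h hz hz')
      · exact Or.inr (hT.eq_of_mem_segment_top h hz hz')

end
end KnotLink

namespace KnotLink
open Filter Topology

/-! ### Generic translations -/

lemma span_pair_ne_top (u v : Space) : Submodule.span ℝ {u, v} ≠ ⊤ := by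
  intro h
  have h1 := finrank_span_le_card (R := ℝ) ({u, v} : Set Space)
  have h2 : Module.finrank ℝ (Submodule.span ℝ ({u, v} : Set Space)) = 3 := by
    rw [h, finrank_top]; simp
  have h3 : ({u, v} : Set Space).toFinset.card ≤ 2 := by
    rw [Set.toFinset_insert, Set.toFinset_singleton]
    exact Finset.card_le_two
  omega

lemma sub_mem_span_of_mem_segment {a b p q : Space} (hp : p ∈ segment ℝ a b)
    (hq : q ∈ segment ℝ a b) (S : Submodule ℝ Space) (hS : b - a ∈ S) : p - q ∈ S := by
  rw [segment_eq_image'] at hp hq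
  obtain ⟨s, -, rfl⟩ := hp
  obtain ⟨t, -, rfl⟩ := hq
  have : a + s • (b - a) - (a + t • (b - a)) = (s - t) • (b - a) := by module
  rw [this]
  exact S.smul_mem _ hS

lemma isCompact_segment (a b : Space) : IsCompact (segment ℝ a b) := by
  rw [segment_eq_image']
  exact isCompact_Icc.image (by fun_prop)

/-- If the segments share a point, differences of their points lie in the span of the two
directions, which contains no nonzero multiple of `w`. If they are disjoint, compactness leaves room
for all sufficiently short translations. -/
lemma eventually_thick_pair {e e' : Space × Space} {w : Space}
    (hw : w ∉ Submodule.span ℝ {e.2 - e.1, e'.2 - e'.1}) :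
    ∀ᶠ t : ℝ in 𝓝[>] 0, ∀ p ∈ segment ℝ e.1 e.2, ∀ q ∈ segment ℝ e'.1 e'.2, ∀ r : ℝ, |r| ≤ 2 →
      p = q + r • t • w → r = 0 := by
  by_cases h : (segment ℝ e.1 e.2 ∩ segment ℝ e'.1 e'.2).Nonempty
  · obtain ⟨z, hz, hz'⟩ := h
    filter_upwards [self_mem_nhdsWithin] with t (ht : 0 < t) p hp q hq r _ he
    by_contra hr
    set S := Submodule.span ℝ {e.2 - e.1, e'.2 - e'.1}
    have h1 : p - z ∈ S := sub_mem_span_of_mem_segment hp hz S (Submodule.subset_span (by simp))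
    have h2 : q - z ∈ S := sub_mem_span_of_mem_segment hq hz' S (Submodule.subset_span (by simp))
    have h3 : (r * t) • w ∈ S := by
      have : (r * t) • w = (p - z) - (q - z) := by rw [he]; module
      rw [this]
      exact S.sub_mem h1 h2
    exact hw ((S.smul_mem_iff (mul_ne_zero hr ht.ne')).1 h3)
  · have key : ∀ᶠ t : ℝ in 𝓝 0, ∀ k ∈ (segment ℝ e.1 e.2 ×ˢ segment ℝ e'.1 e'.2) ×ˢ Set.Icc (-2 : ℝ) 2,
        k.1.1 ≠ k.1.2 + k.2 • t • w := by
      refine IsCompact.eventually_forall_of_forall_eventually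
        (((isCompact_segment _ _).prod (isCompact_segment _ _)).prod isCompact_Icc) fun k hk => ?_
      refine (ContinuousAt.ne_iff_eventually_ne (by fun_prop) (by fun_prop)).1 ?_
      intro he
      rw [zero_smul, smul_zero, add_zero] at he
      exact h ⟨k.1.1, hk.1.1, he ▸ hk.1.2⟩
    filter_upwards [nhdsWithin_le_nhds key] with t ht p hp q hq r hr he
    exact absurd he (ht ((p, q), r) ⟨⟨hp, hq⟩, abs_le.1 hr⟩)

/-- A finite union of segments admits arbitrarily short transverse translations. -/
lemma exists_thick {S : Set (Space × Space)} (hS : S.Finite) :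
    ∃ w : Space, ∀ᶠ t : ℝ in 𝓝[>] 0, Thick (⋃ e ∈ S, segment ℝ e.1 e.2) (t • w) := by
  obtain ⟨w, hw⟩ : ∃ w : Space, ∀ e ∈ S, ∀ e' ∈ S, w ∉ Submodule.span ℝ {e.2 - e.1, e'.2 - e'.1} := by
    classical
    -- A real vector space is not a finite union of proper subspaces, and two directions span at
    -- most a plane.
    have := Subspace.biUnion_ne_univ_of_top_notMem (k := ℝ) (E := Space)
      (s := (hS.toFinset ×ˢ hS.toFinset).image
        fun E => Submodule.span ℝ {E.1.2 - E.1.1, E.2.2 - E.2.1}) (by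
        intro h
        obtain ⟨E, -, hE⟩ := Finset.mem_image.1 h
        exact span_pair_ne_top _ _ hE)
    obtain ⟨w, hw⟩ := (Set.ne_univ_iff_exists_notMem _).1 this
    refine ⟨w, fun e he e' he' hmem => hw ?_⟩
    refine Set.mem_iUnion₂.2 ⟨_, Finset.mem_image.2 ⟨(e, e'), ?_, rfl⟩, hmem⟩
    simpa using ⟨he, he'⟩
  refine ⟨w, ?_⟩
  have := (eventually_all_finite hS).2 fun e he => (eventually_all_finite hS).2 fun e' he' =>
    eventually_thick_pair (hw e he e' he')
  filter_upwards [this] with t ht p hp q hq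
  obtain ⟨e, he, hp⟩ := Set.mem_iUnion₂.1 hp
  obtain ⟨e', he', hq⟩ := Set.mem_iUnion₂.1 hq
  exact ht e he e' he' p hp q hq

end KnotLink

namespace KnotLink
open Filter Topology

/-! ### Stability of regular projections -/

/-- Modulo the first two rows, the third row equals `x - y`. In a linear relation between the rows,
`π` kills `x - y`, so independence of the projected edges removes the first two coefficients; the
third then vanishes because `x ≠ y`. -/
lemma det_ne_zero_of_crossing {π : Space →ₗ[ℝ] (Fin 2 → ℝ)} {a b c d x y : Space}
    (hx : x ∈ segment ℝ a b) (hy : y ∈ segment ℝ c d) (hxy : π x = π y) (hne : x ≠ y)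
    (hli : LinearIndependent ℝ ![π (b - a), π (d - c)]) :
    Matrix.det (Matrix.of ![b - a, d - c, a - c]) ≠ 0 := by
  intro h0
  obtain ⟨v, hv, hv0⟩ := Matrix.exists_vecMul_eq_zero_iff.2 h0
  rw [segment_eq_image'] at hx hy
  obtain ⟨r, -, rfl⟩ := hx
  obtain ⟨s, -, rfl⟩ := hy
  have hsum : v 0 • (b - a) + v 1 • (d - c) + v 2 • (a - c) = 0 := by
    rw [← hv0]
    ext i
    simp [Matrix.vecMul, dotProduct, Fin.sum_univ_three]
  rw [LinearIndependent.pair_iff] at hli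
  have e1 : (v 0 - v 2 * r) • (b - a) + (v 1 + v 2 * s) • (d - c)
      + v 2 • ((a + r • (b - a)) - (c + s • (d - c))) = 0 := by
    rw [← hsum]; module
  have e2 := congrArg π e1
  rw [map_add, map_add, map_smul, map_smul, map_smul, map_sub _ (a + _), hxy, sub_self, smul_zero,
    add_zero, map_zero] at e2
  obtain ⟨h1, h2⟩ := hli _ _ e2
  rw [h1, h2, zero_smul, zero_smul, zero_add, zero_add, smul_eq_zero] at e1
  have h3 := e1.resolve_right (sub_ne_zero.2 hne)
  rw [h3] at h1 h2
  refine hv (funext fun i => ?_)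
  fin_cases i
  · simpa using h1
  · simpa using h2
  · simpa using h3

lemma linearIndependent_pair_fin_two {u v : Fin 2 → ℝ} :
    LinearIndependent ℝ ![u, v] ↔ u 0 * v 1 - u 1 * v 0 ≠ 0 := by
  have := Matrix.linearIndependent_rows_iff_isUnit (A := Matrix.of ![u, v])
  rw [Matrix.isUnit_iff_isUnit_det, isUnit_iff_ne_zero, Matrix.det_fin_two] at this
  simp only [Matrix.of_apply, Matrix.cons_val_zero, Matrix.cons_val_one] at this
  exact this

/-- Cramer's rule for the crossing point of two lines in the plane. -/
lemma crossing_iff {a c u v : Fin 2 → ℝ} {r s : ℝ} (hD : u 0 * v 1 - u 1 * v 0 ≠ 0) :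
    a + r • u = c + s • v ↔
      r = ((c 0 - a 0) * v 1 - (c 1 - a 1) * v 0) / (u 0 * v 1 - u 1 * v 0) ∧
      s = ((c 0 - a 0) * u 1 - (c 1 - a 1) * u 0) / (u 0 * v 1 - u 1 * v 0) := by
  rw [eq_div_iff hD, eq_div_iff hD]
  constructor
  · intro h
    have h0 := congrFun h 0
    have h1 := congrFun h 1
    simp only [Pi.add_apply, Pi.smul_apply, smul_eq_mul] at h0 h1
    constructor
    · linear_combination v 1 * h0 - v 0 * h1
    · linear_combination u 1 * h0 - u 0 * h1
  · rintro ⟨hr, hs⟩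
    ext i
    apply mul_right_cancel₀ hD
    fin_cases i
    · simp only [Fin.zero_eta, Pi.add_apply, Pi.smul_apply, smul_eq_mul]
      linear_combination u 0 * hr - v 0 * hs
    · simp only [Fin.mk_one, Pi.add_apply, Pi.smul_apply, smul_eq_mul]
      linear_combination u 1 * hr - v 1 * hs

/-- The condition of `IsRegularProjection` on a single pair of edges. -/
def RegularPair (π : Space →ₗ[ℝ] (Fin 2 → ℝ)) (e e' : Space × Space) : Prop :=
  ∀ x ∈ segment ℝ e.1 e.2, ∀ y ∈ segment ℝ e'.1 e'.2, π x = π y →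
    x ∈ openSegment ℝ e.1 e.2 ∧ y ∈ openSegment ℝ e'.1 e'.2 ∧
      LinearIndependent ℝ ![π (e.2 - e.1), π (e'.2 - e'.1)]

lemma mem_Ioo_of_mem_openSegment {a b : Space} {r : ℝ} (hab : a ≠ b)
    (h : a + r • (b - a) ∈ openSegment ℝ a b) : r ∈ Set.Ioo (0 : ℝ) 1 := by
  rw [openSegment_eq_image'] at h
  obtain ⟨s, hs, he⟩ := h
  have : s • (b - a) = r • (b - a) := add_left_cancel he
  rwa [← smul_left_injective ℝ (sub_ne_zero.2 hab.symm) this]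

/-- If the projected edges cross, Cramer's rule gives crossing parameters that are continuous at 0
and stay in the open interval, and the determinant, nonzero because the edges are disjoint in space,
keeps its sign. If the projections are disjoint, compactness keeps them disjoint. -/
lemma eventually_regularPair {π : Space →ₗ[ℝ] (Fin 2 → ℝ)} {a b c d : ℝ → Space}
    (ha : Continuous a) (hb : Continuous b) (hc : Continuous c) (hd : Continuous d)
    (h : RegularPair π (a 0, b 0) (c 0, d 0))
    (hdisj : Disjoint (segment ℝ (a 0) (b 0)) (segment ℝ (c 0) (d 0))) :
    ∀ᶠ t in 𝓝 0, RegularPair π (a t, b t) (c t, d t) ∧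
      crossingSign π (a t, b t) (c t, d t) = crossingSign π (a 0, b 0) (c 0, d 0) := by
  have hπ : Continuous π := π.continuous_of_finiteDimensional
  by_cases hne : (π '' segment ℝ (a 0) (b 0) ∩ π '' segment ℝ (c 0) (d 0)).Nonempty
  · obtain ⟨_, ⟨x, hx, rfl⟩, ⟨y, hy, hyx⟩⟩ := hne
    obtain ⟨hxo, hyo, hli⟩ := h x hx y hy hyx.symm
    have hdet := det_ne_zero_of_crossing hx hy hyx.symm
      (fun he => Set.disjoint_left.1 hdisj hx (he ▸ hy)) hli
    set u : ℝ → Fin 2 → ℝ := fun t => π (b t - a t) with hu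
    set v : ℝ → Fin 2 → ℝ := fun t => π (d t - c t) with hv
    have huc : Continuous u := by fun_prop
    have hvc : Continuous v := by fun_prop
    have hD0 : u 0 0 * v 0 1 - u 0 1 * v 0 0 ≠ 0 := linearIndependent_pair_fin_two.1 hli
    set D : ℝ → ℝ := fun t => u t 0 * v t 1 - u t 1 * v t 0 with hD
    have hDc : Continuous D := by fun_prop
    -- The parameters of the crossing point on the two lines, by Cramer's rule.
    set r : ℝ → ℝ := fun t => ((π (c t) 0 - π (a t) 0) * v t 1 - (π (c t) 1 - π (a t) 1) * v t 0)
      / D t with hr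
    set s : ℝ → ℝ := fun t => ((π (c t) 0 - π (a t) 0) * u t 1 - (π (c t) 1 - π (a t) 1) * u t 0)
      / D t with hs
    have hrc : ContinuousAt r 0 := ContinuousAt.div (by fun_prop) (by fun_prop) hD0
    have hsc : ContinuousAt s 0 := ContinuousAt.div (by fun_prop) (by fun_prop) hD0
    have hiff : ∀ t, D t ≠ 0 → ∀ r' s' : ℝ,
        π (a t + r' • (b t - a t)) = π (c t + s' • (d t - c t)) ↔ r' = r t ∧ s' = s t := by
      intro t ht r' s'
      rw [map_add, map_smul, map_add, map_smul]
      exact crossing_iff ht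
    have hab : ∀ t, D t ≠ 0 → a t ≠ b t := fun t ht he => ht (by simp [hD, hu, he])
    have hcd : ∀ t, D t ≠ 0 → c t ≠ d t := fun t ht he => ht (by simp [hD, hv, he])
    have hrs : r 0 ∈ Set.Ioo (0 : ℝ) 1 ∧ s 0 ∈ Set.Ioo (0 : ℝ) 1 := by
      rw [segment_eq_image'] at hx hy
      obtain ⟨r', -, rfl⟩ := hx
      obtain ⟨s', -, rfl⟩ := hy
      obtain ⟨rfl, rfl⟩ := (hiff 0 hD0 r' s').1 hyx.symm
      exact ⟨mem_Ioo_of_mem_openSegment (hab 0 hD0) hxo,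
        mem_Ioo_of_mem_openSegment (hcd 0 hD0) hyo⟩
    have hsign : ∀ᶠ t in 𝓝 (0 : ℝ),
        SignType.sign (Matrix.det (Matrix.of ![b t - a t, d t - c t, a t - c t]))
          = SignType.sign (Matrix.det (Matrix.of ![b 0 - a 0, d 0 - c 0, a 0 - c 0])) := by
      have hcont : Continuous fun t => Matrix.det (Matrix.of ![b t - a t, d t - c t, a t - c t]) := by
        simp only [Matrix.det_fin_three, Matrix.of_apply, Matrix.cons_val]
        fun_prop
      have := (continuousAt_sign_of_ne_zero hdet).comp_of_eq
        (f := fun t => Matrix.det (Matrix.of ![b t - a t, d t - c t, a t - c t]))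
        (x := (0 : ℝ)) hcont.continuousAt rfl
      exact this.eventually ((isOpen_discrete {_}).mem_nhds rfl)
    filter_upwards [hDc.continuousAt.eventually_ne hD0, hrc.eventually (isOpen_Ioo.mem_nhds hrs.1),
      hsc.eventually (isOpen_Ioo.mem_nhds hrs.2), hsign] with t htD htr hts htsign
    constructor
    · intro x hx y hy hxy
      simp only at hx hy ⊢
      rw [segment_eq_image'] at hx hy
      obtain ⟨r', -, rfl⟩ := hx
      obtain ⟨s', -, rfl⟩ := hy
      obtain ⟨rfl, rfl⟩ := (hiff t htD r' s').1 hxy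
      refine ⟨?_, ?_, linearIndependent_pair_fin_two.2 htD⟩
      · rw [openSegment_eq_image']; exact ⟨_, htr, rfl⟩
      · rw [openSegment_eq_image']; exact ⟨_, hts, rfl⟩
    · have hcross : ∀ t, D t ≠ 0 → r t ∈ Set.Ioo (0 : ℝ) 1 → s t ∈ Set.Ioo (0 : ℝ) 1 →
          (π '' segment ℝ (a t) (b t) ∩ π '' segment ℝ (c t) (d t)).Nonempty := by
        intro t htD htr hts
        refine ⟨_, ⟨a t + r t • (b t - a t), ?_, rfl⟩, ⟨c t + s t • (d t - c t), ?_,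
          ((hiff t htD _ _).2 ⟨rfl, rfl⟩).symm⟩⟩
        · rw [segment_eq_image']; exact ⟨_, Set.Ioo_subset_Icc_self htr, rfl⟩
        · rw [segment_eq_image']; exact ⟨_, Set.Ioo_subset_Icc_self hts, rfl⟩
      rw [crossingSign, crossingSign, if_pos (hcross t htD htr hts), if_pos (hcross 0 hD0 hrs.1 hrs.2)]
      simp only
      rw [htsign]
  · have key : ∀ᶠ t : ℝ in 𝓝 0, ∀ k ∈ Set.Icc (0 : ℝ) 1 ×ˢ Set.Icc (0 : ℝ) 1,
        π (a t + k.1 • (b t - a t)) ≠ π (c t + k.2 • (d t - c t)) := by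
      refine IsCompact.eventually_forall_of_forall_eventually
        (isCompact_Icc.prod isCompact_Icc) fun k hk => ?_
      refine (ContinuousAt.ne_iff_eventually_ne (by fun_prop) (by fun_prop)).1 ?_
      intro he
      refine hne ⟨_, ⟨_, ?_, rfl⟩, ⟨_, ?_, he.symm⟩⟩
      · rw [segment_eq_image']; exact ⟨_, hk.1, rfl⟩
      · rw [segment_eq_image']; exact ⟨_, hk.2, rfl⟩
    filter_upwards [key] with t ht
    have hno : ∀ x ∈ segment ℝ (a t) (b t), ∀ y ∈ segment ℝ (c t) (d t), π x ≠ π y := by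
      intro x hx y hy
      rw [segment_eq_image'] at hx hy
      obtain ⟨r', hr, rfl⟩ := hx
      obtain ⟨s', hs, rfl⟩ := hy
      exact ht (r', s') ⟨hr, hs⟩
    refine ⟨fun x hx y hy hxy => absurd hxy (hno x hx y hy), ?_⟩
    rw [crossingSign, crossingSign, if_neg hne, if_neg]
    rintro ⟨_, ⟨x, hx, rfl⟩, ⟨y, hy, hyx⟩⟩
    exact hno x hx y hy hyx.symm

/-- A perturbed path is a list of curves, evaluated at the time `t`; its combinatorics do not depend
on `t`. -/
lemma edges_map_eval (L : List (ℝ → Space)) (t : ℝ) :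
    edges (L.map fun g => g t) = (L.zip L.tail).map fun E => (E.1 t, E.2 t) := by
  rw [edges, ← List.map_tail, List.zip_map]
  rfl

lemma segment_subset_carrier {l : List Space} {e : Space × Space} (he : e ∈ edges l) :
    segment ℝ e.1 e.2 ⊆ carrier l := by
  match l with
  | [] => simp [edges] at he
  | [x] => simp [edges] at he
  | x :: y :: l => exact fun z hz => mem_carrier_cons_cons.2 ⟨e, he, hz⟩

/-- A regular projection of two disjoint polygonal paths remains regular under small perturbations
of the paths, with the same sum of crossing signs. -/
lemma eventually_isRegularProjection {π : Space →ₗ[ℝ] (Fin 2 → ℝ)} {L M : List (ℝ → Space)}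
    (hL : ∀ g ∈ L, Continuous g) (hM : ∀ g ∈ M, Continuous g)
    (h : IsRegularProjection π (L.map fun g => g 0) (M.map fun g => g 0))
    (hdisj : Disjoint (carrier (L.map fun g => g 0)) (carrier (M.map fun g => g 0))) :
    ∀ᶠ t in 𝓝 (0 : ℝ), IsRegularProjection π (L.map fun g => g t) (M.map fun g => g t) ∧
      crossingSum π (L.map fun g => g t) (M.map fun g => g t)
        = crossingSum π (L.map fun g => g 0) (M.map fun g => g 0) := by
  have key : ∀ E ∈ L.zip L.tail, ∀ E' ∈ M.zip M.tail, ∀ᶠ t in 𝓝 (0 : ℝ),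
      RegularPair π (E.1 t, E.2 t) (E'.1 t, E'.2 t) ∧
        crossingSign π (E.1 t, E.2 t) (E'.1 t, E'.2 t)
          = crossingSign π (E.1 0, E.2 0) (E'.1 0, E'.2 0) := by
    intro E hE E' hE'
    have h1 : (E.1 0, E.2 0) ∈ edges (L.map fun g => g 0) := by
      rw [edges_map_eval]; exact List.mem_map.2 ⟨E, hE, rfl⟩
    have h2 : (E'.1 0, E'.2 0) ∈ edges (M.map fun g => g 0) := by
      rw [edges_map_eval]; exact List.mem_map.2 ⟨E', hE', rfl⟩
    refine eventually_regularPair (hL _ (List.of_mem_zip hE).1)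
      (hL _ (List.mem_of_mem_tail (List.of_mem_zip hE).2)) (hM _ (List.of_mem_zip hE').1)
      (hM _ (List.mem_of_mem_tail (List.of_mem_zip hE').2)) ?_ ?_
    · exact h.2 _ h1 _ h2
    · exact hdisj.mono (segment_subset_carrier h1) (segment_subset_carrier h2)
  have := (eventually_all_finite (List.finite_toSet (L.zip L.tail))).2 fun E hE =>
    (eventually_all_finite (List.finite_toSet (M.zip M.tail))).2 fun E' hE' => key E hE E' hE'
  filter_upwards [this] with t ht
  refine ⟨⟨h.1, ?_⟩, ?_⟩
  · rw [edges_map_eval, edges_map_eval]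
    intro e he e' he'
    obtain ⟨E, hE, rfl⟩ := List.mem_map.1 he
    obtain ⟨E', hE', rfl⟩ := List.mem_map.1 he'
    exact (ht E hE E' hE').1
  · simp only [crossingSum, edges_map_eval, List.map_map]
    congr 1
    refine List.map_congr_left fun E hE => ?_
    simp only [Function.comp_apply]
    congr 1
    exact List.map_congr_left fun E' hE' => (ht E hE E' hE').2

/-- Regularity and crossing sum see only the oriented edges, in any order, so a closed walk may be
started anywhere. The carrier alone would not do, as it forgets orientation. -/
lemma isRegularProjection_perm {π : Space →ₗ[ℝ] (Fin 2 → ℝ)} {P P' Q Q' : List Space}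
    (hP : (edges P).Perm (edges P')) (hQ : (edges Q).Perm (edges Q'))
    (h : IsRegularProjection π P Q) : IsRegularProjection π P' Q' :=
  ⟨h.1, fun e he e' he' => h.2 e (hP.mem_iff.2 he) e' (hQ.mem_iff.2 he')⟩

lemma crossingSum_perm {π : Space →ₗ[ℝ] (Fin 2 → ℝ)} {P P' Q Q' : List Space}
    (hP : (edges P).Perm (edges P')) (hQ : (edges Q).Perm (edges Q')) :
    crossingSum π P Q = crossingSum π P' Q' := by
  rw [crossingSum, crossingSum, (hP.map _).sum_eq]
  congr 1
  exact List.map_congr_left fun e _ => (hQ.map _).sum_eq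

end KnotLink

namespace KnotLink

lemma lift_cons_concat (w y : Space) (l : List Space) (x : Space) :
    lift w (y :: (l ++ [x])) = (y + w) :: (l.map (· + w) ++ [x]) :=
  lift_concat w (y :: l) x

/-! ### Lifting a path to variable heights -/

lemma exists_of_mem_carrier_heights {L : List (Space × ℝ)} {w z : Space} (hh : ∀ a ∈ L, |a.2| ≤ 1)
    (hz : z ∈ carrier (L.map fun a => a.1 + a.2 • w)) :
    ∃ p ∈ carrier (L.map Prod.fst), ∃ t : ℝ, |t| ≤ 1 ∧ z = p + t • w := by
  induction L with
  | nil => exact hz.elim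
  | cons x L ih =>
    cases L with
    | nil =>
      exact ⟨x.1, rfl, x.2, hh x (by simp), hz⟩
    | cons y L =>
      rcases hz with hz | hz
      · rw [segment_eq_image'] at hz
        obtain ⟨s, ⟨hs, hs'⟩, rfl⟩ := hz
        refine ⟨x.1 + s • (y.1 - x.1), Or.inl ?_, x.2 + s * (y.2 - x.2), ?_, by module⟩
        · rw [segment_eq_image']; exact ⟨s, ⟨hs, hs'⟩, rfl⟩
        · have h1 := abs_le.1 (hh x (by simp))
          have h2 := abs_le.1 (hh y (by simp))
          rw [abs_le]
          constructor <;> nlinarith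
      · obtain ⟨p, hp, h⟩ := ih (fun a ha => hh a (List.mem_cons_of_mem _ ha)) hz
        exact ⟨p, Or.inr hp, h⟩

/-- Heights interpolate linearly and stay in [-1, 1]. By thickness, coinciding points of the raised
path have the same foot point, so simplicity is inherited from the path below. -/
lemma isSimpleArc_heights {L : List (Space × ℝ)} {w : Space} (h : IsSimpleArc (L.map Prod.fst))
    (hT : Thick (carrier (L.map Prod.fst)) w) (hh : ∀ a ∈ L, |a.2| ≤ 1) :
    IsSimpleArc (L.map fun a => a.1 + a.2 • w) := by
  induction L with
  | nil => exact h
  | cons x L ih =>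
    cases L with
    | nil => trivial
    | cons y L =>
      have hx := hh x (by simp)
      have hy := hh y (by simp)
      have hL : ∀ a ∈ y :: L, |a.2| ≤ 1 := fun a ha => hh a (List.mem_cons_of_mem _ ha)
      refine ⟨fun he => h.1 ?_, Set.Subset.antisymm ?_ ?_,
        ih h.2.2 (hT.mono fun _ hz => Or.inr hz) hL⟩
      · exact (hT.eq_and_eq (Or.inl (left_mem_segment ℝ _ _)) (Or.inl (right_mem_segment ℝ _ _))
          hx hy he).1
      · rintro z ⟨hz, hz'⟩
        obtain ⟨p, hp, t, ht, hpz⟩ := exists_of_mem_carrier_heights hL hz'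
        rw [segment_eq_image'] at hz
        obtain ⟨s, ⟨hs, hs'⟩, rfl⟩ := hz
        have hm : x.1 + s • (y.1 - x.1) ∈ segment ℝ x.1 y.1 := by
          rw [segment_eq_image']; exact ⟨s, ⟨hs, hs'⟩, rfl⟩
        have := (hT.eq_and_eq (s := x.2 + s * (y.2 - x.2)) (Or.inl hm) (Or.inr hp) (by
          rw [abs_le] at hx hy ⊢
          constructor <;> nlinarith) ht (by rw [← hpz]; module)).1
        have h5 : x.1 + s • (y.1 - x.1) ∈ ({y.1} : Set Space) := by
          rw [← h.2.1]; exact ⟨hm, this ▸ hp⟩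
        have h6 : (s - 1) • (y.1 - x.1) = 0 := by
          have : (s - 1) • (y.1 - x.1) = x.1 + s • (y.1 - x.1) - y.1 := by module
          rw [this, Set.mem_singleton_iff.1 h5, sub_self]
        have h7 := (smul_eq_zero.1 h6).resolve_right (sub_ne_zero.2 h.1.symm)
        obtain rfl : s = 1 := by linarith
        show _ = _
        module
      · rintro z rfl
        exact ⟨right_mem_segment ℝ _ _, head_mem_carrier _ _⟩

/-! ### Replacing a Y by a triangle -/

section
variable {V V' : Type*} {G : SimpleGraph V} {G' : SimpleGraph V'} {a b c : V}

/-- The polygonal arc that is the image of an edge. -/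
def SpatialGraph.arc (f : SpatialGraph G) (u v : V) : List Space :=
  f.pos u :: (f.bend u v ++ [f.pos v])

/-- The union of the images of all vertices and edges. -/
def SpatialGraph.image (f : SpatialGraph G) : Set Space :=
  {z | (∃ u, z = f.pos u) ∨ ∃ u v, G.Adj u v ∧ z ∈ carrier (f.arc u v)}

lemma SpatialGraph.carrier_arc_subset (f : SpatialGraph G) {u v : V} (h : G.Adj u v) :
    carrier (f.arc u v) ⊆ f.image := fun _ hz => Or.inr ⟨u, v, h, hz⟩

lemma SpatialGraph.pos_mem_image (f : SpatialGraph G) (u : V) : f.pos u ∈ f.image := Or.inl ⟨u, rfl⟩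

lemma SpatialGraph.arc_reverse (f : SpatialGraph G) {u v : V} (h : G.Adj u v) :
    f.arc v u = (f.arc u v).reverse := by
  simp [arc, f.bend_symm u v h]

lemma SpatialGraph.carrier_arc_symm (f : SpatialGraph G) {u v : V} (h : G.Adj u v) :
    carrier (f.arc v u) = carrier (f.arc u v) := by
  rw [f.arc_reverse h, carrier_reverse]

/-- The edges of the triangle `abc`. -/
def triangleEdges (a b c : V) : Set (Sym2 V) := {s(a, b), s(b, c), s(c, a)}

open Classical in
/-- The heights of the edges of the triangle `abc` over the Y. -/
noncomputable def level (a b c : V) (e : Sym2 V) : ℝ :=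
  if e = s(a, b) then 1 else if e = s(c, a) then -1 else 0

lemma abs_level_le (a b c : V) (e : Sym2 V) : |level a b c e| ≤ 1 := by
  unfold level; split_ifs <;> simp

lemma level_eq_zero {e : Sym2 V} (he : e ∉ triangleEdges a b c) : level a b c e = 0 := by
  simp only [triangleEdges, Set.mem_insert_iff, Set.mem_singleton_iff, not_or] at he
  simp [level, he]

/-- The levels are 1, 0 and -1. If two edges have a common point at heights `r * l = r' * l'` with
`r, r' ≥ 0`, then the square of this height is `(r * r') * (l * l') ≤ 0`, so the height is zero. -/
lemma level_mul_nonpos {e e' : Sym2 V} (he : e ∈ triangleEdges a b c)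
    (he' : e' ∈ triangleEdges a b c) (hne : e ≠ e') :
    level a b c e ≠ level a b c e' ∧ level a b c e * level a b c e' ≤ 0 := by
  simp only [triangleEdges, Set.mem_insert_iff, Set.mem_singleton_iff] at he he'
  have key : ∀ e ∈ triangleEdges a b c, e ≠ s(a, b) → e ≠ s(c, a) → e = s(b, c) := by
    rintro e (h | h | h) h1 h2 <;> simp_all
  unfold level
  split_ifs with h1 h2 h3 h4 h5 h6 <;>
    first
    | exact absurd (h1.trans h2.symm) hne
    | (constructor <;> norm_num; done)
    | skip
  all_goals grind

/-- The graph `G'` arises from `G` by replacing the triangle `abc` by a Y with the new vertex `centre`;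
the vertices of `G` are embedded in those of `G'` by `ι`. -/
structure YMove (G : SimpleGraph V) (G' : SimpleGraph V') (a b c : V) where
  ι : V → V'
  centre : V'
  ι_injective : Function.Injective ι
  ι_ne : ∀ x, ι x ≠ centre
  eq_or : ∀ y, y = centre ∨ ∃ x, y = ι x
  adj_ι : ∀ x y, G'.Adj (ι x) (ι y) ↔ G.Adj x y ∧ s(x, y) ∉ triangleEdges a b c
  adj_centre : ∀ x, G'.Adj centre (ι x) ↔ x = a ∨ x = b ∨ x = c
  hab : G.Adj a b
  hbc : G.Adj b c
  hca : G.Adj c a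

namespace YMove
variable (Y : YMove G G' a b c) (f : SpatialGraph G')

lemma adj_of_mem (Y : YMove G G' a b c) {x y : V} (h : s(x, y) ∈ triangleEdges a b c) : G.Adj x y := by
  have h1 := Y.hab
  have h2 := Y.hbc
  have h3 := Y.hca
  rw [← SimpleGraph.mem_edgeSet] at h1 h2 h3 ⊢
  rcases h with h | h | h <;> rw [h] <;> assumption

lemma adj_centre_of_mem {x y : V} (h : s(x, y) ∈ triangleEdges a b c) :
    G'.Adj Y.centre (Y.ι x) := by
  rw [Y.adj_centre]
  simp only [triangleEdges, Set.mem_insert_iff, Set.mem_singleton_iff, Sym2.eq_iff] at h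
  tauto

lemma adj_centre_of_mem' {x y : V} (h : s(x, y) ∈ triangleEdges a b c) :
    G'.Adj Y.centre (Y.ι y) := Y.adj_centre_of_mem (by rwa [Sym2.eq_swap])

/-- The arm of the Y that ends in `x`, as a path from the centre. -/
abbrev arm (x : V) : List Space := f.arc Y.centre (Y.ι x)

open Classical in
/-- The break points of the new edges. -/
noncomputable def bend (w : Space) (x y : V) : List Space :=
  if s(x, y) ∈ triangleEdges a b c then
    (f.bend (Y.ι x) Y.centre ++ f.pos Y.centre :: f.bend Y.centre (Y.ι y)).map
      (· + level a b c s(x, y) • w)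
  else f.bend (Y.ι x) (Y.ι y)

/-- The polygonal arcs of the new edges. -/
noncomputable def newArc (w : Space) (x y : V) : List Space :=
  f.pos (Y.ι x) :: (Y.bend f w x y ++ [f.pos (Y.ι y)])

open Classical in
/-- The part of the Y-graph that a new edge follows. -/
noncomputable def base (x y : V) : Set Space :=
  if s(x, y) ∈ triangleEdges a b c then carrier (Y.arm f x) ∪ carrier (Y.arm f y)
  else carrier (f.arc (Y.ι x) (Y.ι y))

/-- The arms are read from the centre outwards because `lift` keeps the last point fixed: the two
lifted arms join over the centre and end in the vertices `x` and `y`. -/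
lemma carrier_newArc_of_mem {x y : V} (w : Space) (h : s(x, y) ∈ triangleEdges a b c) :
    carrier (Y.newArc f w x y) = carrier (lift (level a b c s(x, y) • w) (Y.arm f x)) ∪
      carrier (lift (level a b c s(x, y) • w) (Y.arm f y)) := by
  rw [newArc, bend, if_pos h, arm, arm, SpatialGraph.arc, SpatialGraph.arc, lift_cons_concat,
    lift_cons_concat]
  set W := level a b c s(x, y) • w
  simp only [List.map_append, List.map_cons, List.append_assoc, List.cons_append]
  rw [← List.cons_append, carrier_append_cons, ← carrier_reverse]
  congr 2
  have := f.bend_symm _ _ (Y.adj_centre_of_mem h)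
  simp [this]

lemma newArc_of_notMem {x y : V} (w : Space) (h : s(x, y) ∉ triangleEdges a b c) :
    Y.newArc f w x y = f.arc (Y.ι x) (Y.ι y) := by
  rw [newArc, bend, if_neg h]; rfl

variable {f}

lemma getLast?_arm (x : V) : (Y.arm f x).getLast? = some (f.pos (Y.ι x)) :=
  List.getLast?_concat (l := f.pos Y.centre :: f.bend Y.centre (Y.ι x))

lemma base_subset {x y : V} (h : G.Adj x y) : Y.base f x y ⊆ f.image := by
  unfold base
  split_ifs with hT
  · exact Set.union_subset (f.carrier_arc_subset (Y.adj_centre_of_mem hT))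
      (f.carrier_arc_subset (Y.adj_centre_of_mem' hT))
  · exact f.carrier_arc_subset ((Y.adj_ι x y).2 ⟨h, hT⟩)

/-- For an edge of the triangle this is `lift_mem` on each arm. The last clause says that an edge of
nonzero level returns to height zero only in its ends. -/
lemma exists_of_mem_newArc {x y : V} {w z : Space} (hz : z ∈ carrier (Y.newArc f w x y)) :
    ∃ p ∈ Y.base f x y, ∃ r : ℝ, 0 ≤ r ∧ r ≤ 1 ∧ z = p + (r * level a b c s(x, y)) • w ∧
      (r * level a b c s(x, y) = 0 → level a b c s(x, y) ≠ 0 →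
        p = f.pos (Y.ι x) ∨ p = f.pos (Y.ι y)) := by
  by_cases hT : s(x, y) ∈ triangleEdges a b c
  · rw [Y.carrier_newArc_of_mem f w hT] at hz
    rw [base, if_pos hT]
    rcases hz with hz | hz
    all_goals
      obtain ⟨p, hp, t, h0, h1, he, hl⟩ := lift_mem hz
      rw [Y.getLast?_arm] at hl
    · refine ⟨p, Or.inl hp, t, h0, h1, by rw [he, smul_smul], fun h h' => Or.inl ?_⟩
      simpa using (hl ((mul_eq_zero.1 h).resolve_right h')).symm
    · refine ⟨p, Or.inr hp, t, h0, h1, by rw [he, smul_smul], fun h h' => Or.inr ?_⟩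
      simpa using (hl ((mul_eq_zero.1 h).resolve_right h')).symm
  · rw [Y.newArc_of_notMem f w hT] at hz
    rw [base, if_neg hT, level_eq_zero hT]
    exact ⟨z, hz, 0, le_rfl, zero_le_one, by simp, by simp⟩

lemma arm_inter_arm {x y : V} (hx : G'.Adj Y.centre (Y.ι x)) (hy : G'.Adj Y.centre (Y.ι y))
    (hxy : x ≠ y) : carrier (Y.arm f x) ∩ carrier (Y.arm f y) ⊆ {f.pos Y.centre} := by
  intro z hz
  obtain ⟨u, ⟨hu, hu'⟩, rfl⟩ := f.arc_arc _ _ _ _ hx hy (by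
    rw [Ne, Sym2.congr_right]; exact fun h => hxy (Y.ι_injective h)) hz
  rcases hu with rfl | rfl
  · rfl
  · rcases hu' with h | h
    · exact absurd h (Y.ι_ne x)
    · exact absurd (Y.ι_injective h) hxy

lemma eq_of_pos_mem_arm {x y : V} (hx : G'.Adj Y.centre (Y.ι x))
    (h : f.pos (Y.ι y) ∈ carrier (Y.arm f x)) : y = x := by
  rcases f.vertex_arc _ _ _ hx h with h | h
  · exact absurd h (Y.ι_ne y)
  · exact Y.ι_injective h

lemma eq_of_pos_mem_base {x y u : V} (h : G.Adj x y) (hu : f.pos (Y.ι u) ∈ Y.base f x y) :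
    u = x ∨ u = y := by
  unfold base at hu
  split_ifs at hu with hT
  · rcases hu with hu | hu
    · exact Or.inl (Y.eq_of_pos_mem_arm (Y.adj_centre_of_mem hT) hu)
    · exact Or.inr (Y.eq_of_pos_mem_arm (Y.adj_centre_of_mem' hT) hu)
  · rcases f.vertex_arc _ _ _ ((Y.adj_ι x y).2 ⟨h, hT⟩) hu with h | h
    · exact Or.inl (Y.ι_injective h)
    · exact Or.inr (Y.ι_injective h)

/-- An arm of the Y meets an edge that survives only in a vertex. -/
lemma arm_inter_arc {x u v : V} {z : Space} (hx : G'.Adj Y.centre (Y.ι x))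
    (huv : G'.Adj (Y.ι u) (Y.ι v)) (hz : z ∈ carrier (Y.arm f x))
    (hz' : z ∈ carrier (f.arc (Y.ι u) (Y.ι v))) : z = f.pos (Y.ι x) ∧ (x = u ∨ x = v) := by
  obtain ⟨t, ⟨ht, ht'⟩, rfl⟩ := f.arc_arc _ _ _ _ hx huv (by
    intro h
    rcases Sym2.eq_iff.1 h with h | h
    · exact Y.ι_ne _ h.1.symm
    · exact Y.ι_ne _ h.1.symm) ⟨hz, hz'⟩
  rcases ht with rfl | rfl
  · rcases ht' with h | h <;> exact absurd h.symm (Y.ι_ne _)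
  · refine ⟨rfl, ?_⟩
    rcases ht' with h | h
    · exact Or.inl (Y.ι_injective h)
    · exact Or.inr (Y.ι_injective h)

lemma base_inter {u v x y : V} (huv : G.Adj u v) (hxy : G.Adj x y) (hne : s(u, v) ≠ s(x, y))
    (hT : s(u, v) ∉ triangleEdges a b c ∨ s(x, y) ∉ triangleEdges a b c) {z : Space}
    (hz : z ∈ Y.base f u v) (hz' : z ∈ Y.base f x y) :
    ∃ t, t ∈ ({u, v} : Set V) ∩ {x, y} ∧ f.pos (Y.ι t) = z := by
  unfold base at hz hz'
  by_cases h1 : s(u, v) ∈ triangleEdges a b c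
  · have h2 := hT.resolve_left (not_not.2 h1)
    rw [if_pos h1] at hz
    rw [if_neg h2] at hz'
    have hA := (Y.adj_ι x y).2 ⟨hxy, h2⟩
    rcases hz with hz | hz
    · obtain ⟨rfl, h⟩ := Y.arm_inter_arc (Y.adj_centre_of_mem h1) hA hz hz'
      exact ⟨u, ⟨by simp, by simpa using h⟩, rfl⟩
    · obtain ⟨rfl, h⟩ := Y.arm_inter_arc (Y.adj_centre_of_mem' h1) hA hz hz'
      exact ⟨v, ⟨by simp, by simpa using h⟩, rfl⟩
  · have hA := (Y.adj_ι u v).2 ⟨huv, h1⟩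
    rw [if_neg h1] at hz
    by_cases h2 : s(x, y) ∈ triangleEdges a b c
    · rw [if_pos h2] at hz'
      rcases hz' with hz' | hz'
      · obtain ⟨rfl, h⟩ := Y.arm_inter_arc (Y.adj_centre_of_mem h2) hA hz' hz
        exact ⟨x, ⟨by simpa using h, by simp⟩, rfl⟩
      · obtain ⟨rfl, h⟩ := Y.arm_inter_arc (Y.adj_centre_of_mem' h2) hA hz' hz
        exact ⟨y, ⟨by simpa using h, by simp⟩, rfl⟩
    · rw [if_neg h2] at hz'
      obtain ⟨t, ⟨ht, ht'⟩, rfl⟩ := f.arc_arc _ _ _ _ hA ((Y.adj_ι x y).2 ⟨hxy, h2⟩) (by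
        intro h
        apply hne
        have : Sym2.map Y.ι s(u, v) = Sym2.map Y.ι s(x, y) := h
        exact Sym2.map.injective Y.ι_injective this) ⟨hz, hz'⟩
      rcases ht with rfl | rfl
      · refine ⟨u, ⟨by simp, ?_⟩, rfl⟩
        simpa [Y.ι_injective.eq_iff] using ht'
      · refine ⟨v, ⟨by simp, ?_⟩, rfl⟩
        simpa [Y.ι_injective.eq_iff] using ht'

lemma abs_mul_level_le {r : ℝ} (h0 : 0 ≤ r) (h1 : r ≤ 1) (e : Sym2 V) :
    |r * level a b c e| ≤ 1 := by
  rw [abs_mul, abs_of_nonneg h0]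
  exact mul_le_one₀ h1 (abs_nonneg _) (abs_level_le _ _ _ _)

lemma isSimpleArc_newArc {w : Space} (hw : Thick f.image w) {x y : V} (h : G.Adj x y) :
    IsSimpleArc (Y.newArc f w x y) := by
  by_cases hT : s(x, y) ∈ triangleEdges a b c
  · have hx := Y.adj_centre_of_mem hT
    have hy := Y.adj_centre_of_mem' hT
    set l := f.bend (Y.ι x) Y.centre ++ f.pos Y.centre :: f.bend Y.centre (Y.ι y) with hl
    have hcar : carrier (f.pos (Y.ι x) :: (l ++ [f.pos (Y.ι y)])) =
        carrier (Y.arm f x) ∪ carrier (Y.arm f y) := by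
      have := carrier_append_cons (f.pos (Y.ι x) :: f.bend (Y.ι x) Y.centre) (f.pos Y.centre)
        (f.bend Y.centre (Y.ι y) ++ [f.pos (Y.ι y)])
      rw [← f.carrier_arc_symm hx]
      simpa only [hl, arm, SpatialGraph.arc, List.append_assoc, List.cons_append] using this
    have hs : IsSimpleArc (f.pos (Y.ι x) :: (l ++ [f.pos (Y.ι y)])) := by
      have h1 := Y.arm_inter_arm (f := f) hx hy h.ne
      rw [← f.carrier_arc_symm hx] at h1
      have := isSimpleArc_append (l₁ := f.pos (Y.ι x) :: f.bend (Y.ι x) Y.centre)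
        (f.arc_simple _ _ hx.symm) (f.arc_simple _ _ hy) h1
      simpa only [hl, List.append_assoc, List.cons_append] using this
    -- The ends keep height zero; every inner break point, the centre included, receives the level
    -- of the edge.
    have := isSimpleArc_heights (w := w) (L := (f.pos (Y.ι x), 0) ::
      (l.map (fun p => (p, level a b c s(x, y))) ++ [(f.pos (Y.ι y), 0)])) ?_ ?_ ?_
    · rw [newArc, bend, if_pos hT, ← hl]
      simpa [Function.comp_def] using this
    · simpa [Function.comp_def] using hs
    · have h1 : ((f.pos (Y.ι x), 0) :: (l.map (fun p => (p, level a b c s(x, y)))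
          ++ [(f.pos (Y.ι y), (0 : ℝ))])).map Prod.fst = f.pos (Y.ι x) :: (l ++ [f.pos (Y.ι y)]) := by
        simp [Function.comp_def]
      rw [h1, hcar]
      exact hw.mono (Set.union_subset (f.carrier_arc_subset hx) (f.carrier_arc_subset hy))
    · intro p hp
      simp only [List.mem_cons, List.mem_append, List.mem_map, List.not_mem_nil, or_false] at hp
      rcases hp with rfl | ⟨q, -, rfl⟩ | rfl
      · simp
      · exact abs_level_le _ _ _ _
      · simp
  · rw [Y.newArc_of_notMem f w hT]
    exact f.arc_simple _ _ ((Y.adj_ι x y).2 ⟨h, hT⟩)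

/-- The embedding of `G` obtained from an embedding of `G'` by replacing the Y by a triangle whose
edges run parallel to the arms of the Y. -/
noncomputable def embed (w : Space) (hw : Thick f.image w) : SpatialGraph G where
  pos x := f.pos (Y.ι x)
  bend := Y.bend f w
  bend_symm u v h := by
    unfold bend
    rw [Sym2.eq_swap (a := v)]
    split_ifs with hT
    · rw [f.bend_symm _ _ (Y.adj_centre_of_mem hT), f.bend_symm _ _ (Y.adj_centre_of_mem' hT)]
      simp
    · exact f.bend_symm _ _ ((Y.adj_ι u v).2 ⟨h, hT⟩)
  pos_injective := f.pos_injective.comp Y.ι_injective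
  arc_simple u v h := Y.isSimpleArc_newArc hw h
  vertex_arc u v x h hx := by
    obtain ⟨p, hp, r, h0, h1, he, -⟩ := Y.exists_of_mem_newArc hx
    -- A vertex is a point of the image at height zero, so it must be the foot point itself.
    obtain ⟨rfl, -⟩ := hw.eq_and_eq (s := 0) (f.pos_mem_image _) (Y.base_subset h hp) (by simp)
      (abs_mul_level_le h0 h1 _) (by simpa using he)
    exact Y.eq_of_pos_mem_base h hp
  arc_arc u v x y h h' hne := by
    rintro z ⟨hz, hz'⟩
    obtain ⟨p, hp, r, h0, h1, rfl, hr⟩ := Y.exists_of_mem_newArc hz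
    obtain ⟨p', hp', r', h0', h1', he, hr'⟩ := Y.exists_of_mem_newArc hz'
    obtain ⟨rfl, heq⟩ := hw.eq_and_eq (Y.base_subset h hp) (Y.base_subset h' hp')
      (abs_mul_level_le h0 h1 _) (abs_mul_level_le h0' h1' _) he
    by_cases hT : s(u, v) ∉ triangleEdges a b c ∨ s(x, y) ∉ triangleEdges a b c
    · have hlev : r * level a b c s(u, v) = 0 := by
        rcases hT with hT | hT
        · rw [level_eq_zero hT, mul_zero]
        · rw [heq, level_eq_zero hT, mul_zero]
      rw [hlev, zero_smul, add_zero]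
      exact Y.base_inter h h' hne hT hp hp'
    · push Not at hT
      obtain ⟨hl, hl'⟩ := level_mul_nonpos hT.1 hT.2 hne
      have hlev : r * level a b c s(u, v) = 0 := by
        have : (r * level a b c s(u, v)) ^ 2
            = (r * r') * (level a b c s(u, v) * level a b c s(x, y)) := by
          rw [sq]; nth_rewrite 2 [heq]; ring
        have h2 : (r * level a b c s(u, v)) ^ 2 ≤ 0 := by
          rw [this]; exact mul_nonpos_of_nonneg_of_nonpos (by positivity) hl'
        exact pow_eq_zero_iff (two_ne_zero) |>.1 (le_antisymm h2 (sq_nonneg _))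
      rw [hlev, zero_smul, add_zero]
      -- At most one of the two levels is zero; the edge of nonzero level is at height zero only in
      -- its ends, so the common point is a vertex.
      by_cases h3 : level a b c s(u, v) = 0
      · rcases hr' (heq ▸ hlev) (fun h4 => hl (h3.trans h4.symm)) with rfl | rfl
        · exact ⟨x, ⟨by simpa using Y.eq_of_pos_mem_base h hp, by simp⟩, rfl⟩
        · exact ⟨y, ⟨by simpa using Y.eq_of_pos_mem_base h hp, by simp⟩, rfl⟩
      · rcases hr hlev h3 with rfl | rfl
        · exact ⟨u, ⟨by simp, by simpa using Y.eq_of_pos_mem_base h' hp'⟩, rfl⟩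
        · exact ⟨v, ⟨by simp, by simpa using Y.eq_of_pos_mem_base h' hp'⟩, rfl⟩

end YMove
end
end KnotLink

namespace KnotLink

/-! ### Sweeping the edges of the triangle onto the Y -/

lemma Thick.smul {X : Set Space} {w : Space} (h : Thick X w) {s : ℝ} (hs : |s| ≤ 1) (hs0 : s ≠ 0) :
    Thick X (s • w) := fun p hp q hq t ht he => by
  have := h p hp q hq (t * s) (by
    rw [abs_mul]; exact (mul_le_of_le_one_right (abs_nonneg t) hs).trans ht) (by rw [he, smul_smul])
  exact (mul_eq_zero.1 this).resolve_right hs0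

lemma lift_zero (l : List Space) : lift 0 l = l := by
  induction l with
  | nil => rfl
  | cons x l ih =>
    cases l with
    | nil => rfl
    | cons y l => rw [lift, ih, add_zero]

section
variable {V V' : Type*} {G : SimpleGraph V} {G' : SimpleGraph V'} {a b c : V}

namespace YMove
variable (Y : YMove G G' a b c) {f : SpatialGraph G'} {w W : Space} {x y : V} {R : Set Space}

lemma exists_arm_eq (f : SpatialGraph G') (x : V) :
    ∃ q l, Y.arm f x = f.pos Y.centre :: q :: l := by
  unfold arm SpatialGraph.arc
  cases f.bend Y.centre (Y.ι x) with
  | nil => exact ⟨_, _, rfl⟩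
  | cons q l => exact ⟨_, _, rfl⟩

lemma arm_lower (hW : Thick f.image W) (hx : G'.Adj Y.centre (Y.ι x))
    (hR : R ∩ wall (carrier (Y.arm f x)) W ⊆ {f.pos Y.centre + W, f.pos (Y.ι x)}) :
    KnotEquiv (R ∪ carrier (lift W (Y.arm f x)))
      (R ∪ (carrier (Y.arm f x) ∪ segment ℝ (f.pos Y.centre) (f.pos Y.centre + W))) := by
  obtain ⟨q, l, h⟩ := Y.exists_arm_eq f x
  have h1 : IsSimpleArc (Y.arm f x) := f.arc_simple _ _ hx
  have h2 : Thick (carrier (Y.arm f x)) W := hW.mono (f.carrier_arc_subset hx)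
  have h3 := Y.getLast?_arm (f := f) x
  rw [h] at h1 h2 h3 hR ⊢
  exact knotEquiv_lift_lower h1 h2 h3 hR

lemma arm_lower_foot (hW : Thick f.image W) (hx : G'.Adj Y.centre (Y.ι x))
    (hR : R ∩ wall (carrier (Y.arm f x)) W ⊆ {f.pos Y.centre, f.pos (Y.ι x)}) :
    KnotEquiv (R ∪ (carrier (lift W (Y.arm f x)) ∪
      segment ℝ (f.pos Y.centre) (f.pos Y.centre + W))) (R ∪ carrier (Y.arm f x)) := by
  obtain ⟨q, l, h⟩ := Y.exists_arm_eq f x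
  have h1 : IsSimpleArc (Y.arm f x) := f.arc_simple _ _ hx
  have h2 : Thick (carrier (Y.arm f x)) W := hW.mono (f.carrier_arc_subset hx)
  have h3 := Y.getLast?_arm (f := f) x
  rw [h] at h1 h2 h3 hR ⊢
  exact knotEquiv_lift_lower_foot h1 h2 h3 hR

lemma arm_collapse (hW : Thick f.image W) (hx : G'.Adj Y.centre (Y.ι x))
    (hR : R ∩ wall (carrier (Y.arm f x)) W ⊆ {f.pos Y.centre, f.pos Y.centre + W}) :
    KnotEquiv (R ∪ (carrier (lift W (Y.arm f x)) ∪ carrier (Y.arm f x)))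
      (R ∪ segment ℝ (f.pos Y.centre) (f.pos Y.centre + W)) := by
  obtain ⟨q, l, h⟩ := Y.exists_arm_eq f x
  have h1 : IsSimpleArc (Y.arm f x) := f.arc_simple _ _ hx
  have h2 : Thick (carrier (Y.arm f x)) W := hW.mono (f.carrier_arc_subset hx)
  rw [h] at h1 h2 hR ⊢
  exact knotEquiv_collapse h1 h2 hR

lemma arm_trivial (hW : Thick f.image W) (hx : G'.Adj Y.centre (Y.ι x)) :
    IsTrivialKnot (segment ℝ (f.pos Y.centre) (f.pos Y.centre + W) ∪
      (carrier (lift W (Y.arm f x)) ∪ carrier (Y.arm f x))) := by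
  obtain ⟨q, l, h⟩ := Y.exists_arm_eq f x
  have h1 : IsSimpleArc (Y.arm f x) := f.arc_simple _ _ hx
  have h2 : Thick (carrier (Y.arm f x)) W := hW.mono (f.carrier_arc_subset hx)
  rw [h] at h1 h2 ⊢
  exact isTrivialKnot_boundary h1 h2

/-- A common point has its foot on both arms, hence at the centre, and over the centre the lifted
arm has height one. -/
lemma lift_arm_inter_wall (hW : Thick f.image W) (hx : G'.Adj Y.centre (Y.ι x))
    (hy : G'.Adj Y.centre (Y.ι y)) (hxy : x ≠ y) :
    carrier (lift W (Y.arm f x)) ∩ wall (carrier (Y.arm f y)) W ⊆ {f.pos Y.centre + W} := by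
  rintro z ⟨hz, hz'⟩
  obtain ⟨p, hp, t, h0, h1, rfl, -⟩ := lift_mem hz
  have hpy := hW.mem_wall (f.carrier_arc_subset hy) (f.carrier_arc_subset hx hp) h0 h1 hz'
  obtain rfl : p = f.pos Y.centre := Y.arm_inter_arm hx hy hxy ⟨hp, hpy⟩
  obtain ⟨q, l, h⟩ := Y.exists_arm_eq f x
  have h3 : IsSimpleArc (Y.arm f x) := f.arc_simple _ _ hx
  have h4 : Thick (carrier (Y.arm f x)) W := hW.mono (f.carrier_arc_subset hx)
  rw [h] at h3 h4 hz
  exact eq_of_mem_lift h3 h4 h0 h1 hz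

lemma arm_inter_wall (hW : Thick f.image W) (hx : G'.Adj Y.centre (Y.ι x))
    (hy : G'.Adj Y.centre (Y.ι y)) (hxy : x ≠ y) :
    carrier (Y.arm f x) ∩ wall (carrier (Y.arm f y)) W ⊆ {f.pos Y.centre} := by
  rintro z ⟨hz, hz'⟩
  have hpy := hW.mem_wall (t := 0) (f.carrier_arc_subset hy) (f.carrier_arc_subset hx hz) le_rfl
    zero_le_one (by simpa using hz')
  exact Y.arm_inter_arm hx hy hxy ⟨hz, hpy⟩

lemma pos_notMem_wall (hW : Thick f.image W) (hy : G'.Adj Y.centre (Y.ι y)) (hxy : x ≠ y) :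
    f.pos (Y.ι x) ∉ wall (carrier (Y.arm f y)) W := fun h =>
  hxy (Y.eq_of_pos_mem_arm hy (hW.mem_wall (t := 0) (f.carrier_arc_subset hy) (f.pos_mem_image _)
    le_rfl zero_le_one (by simpa using h)))

/-- An edge of the triangle is moved to the two arms of the Y that it follows. -/
lemma newArc_lower (hw : Thick f.image w) (hT : s(x, y) ∈ triangleEdges a b c)
    (hR : level a b c s(x, y) ≠ 0 →
      R ∩ wall (carrier (Y.arm f x) ∪ carrier (Y.arm f y)) (level a b c s(x, y) • w) ⊆
        {f.pos (Y.ι x), f.pos (Y.ι y)}) :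
    KnotEquiv (R ∪ carrier (Y.newArc f w x y))
      (R ∪ (carrier (Y.arm f x) ∪ carrier (Y.arm f y))) := by
  have hx := Y.adj_centre_of_mem hT
  have hy := Y.adj_centre_of_mem' hT
  have hxy := (Y.adj_of_mem hT).ne
  rw [Y.carrier_newArc_of_mem f w hT]
  by_cases h0 : level a b c s(x, y) = 0
  · rw [h0, zero_smul, lift_zero, lift_zero]
    exact .refl _
  specialize hR h0
  have hW := hw.smul (abs_level_le a b c s(x, y)) h0
  set W := level a b c s(x, y) • w
  -- Lowering the part over the arm of `y` leaves a vertical segment at the centre, which is the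
  -- foot needed to sweep the wall over the arm of `x`.
  have h1 := Y.arm_lower (R := R ∪ carrier (lift W (Y.arm f x))) hW hy ?_
  · have h2 := Y.arm_lower_foot (R := R ∪ carrier (Y.arm f y)) hW hx ?_
    · refine (h1.congr ?_ rfl).trans (h2.congr ?_ ?_) <;>
      · ext z; simp only [Set.mem_union]; tauto
    · rintro z ⟨hz | hz, hz'⟩
      · rcases hR ⟨hz, wall_mono Set.subset_union_left _ hz'⟩ with rfl | rfl
        · exact Or.inr rfl
        · exact absurd hz' (Y.pos_notMem_wall hW hx hxy.symm)
      · exact Or.inl (Y.arm_inter_wall hW hy hx hxy.symm ⟨hz, hz'⟩)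
  · rintro z ⟨hz | hz, hz'⟩
    · rcases hR ⟨hz, wall_mono Set.subset_union_right _ hz'⟩ with rfl | rfl
      · exact absurd hz' (Y.pos_notMem_wall hW hy hxy)
      · exact Or.inr rfl
    · exact Or.inl (Y.lift_arm_inter_wall hW hx hy hxy ⟨hz, hz'⟩)

/-- An edge of the triangle together with one of the arms that it follows is moved to the other
arm. -/
lemma newArc_collapse (hw : Thick f.image w) (hT : s(x, y) ∈ triangleEdges a b c)
    (h0 : level a b c s(x, y) ≠ 0)
    (hR : R ∩ wall (carrier (Y.arm f x) ∪ carrier (Y.arm f y)) (level a b c s(x, y) • w) ⊆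
        {f.pos Y.centre, f.pos (Y.ι x)}) :
    KnotEquiv (R ∪ (carrier (Y.newArc f w x y) ∪ carrier (Y.arm f y)))
      (R ∪ carrier (Y.arm f x)) := by
  have hx := Y.adj_centre_of_mem hT
  have hy := Y.adj_centre_of_mem' hT
  have hxy := (Y.adj_of_mem hT).ne
  rw [Y.carrier_newArc_of_mem f w hT]
  have hW := hw.smul (abs_level_le a b c s(x, y)) h0
  set W := level a b c s(x, y) • w
  -- The wall over the arm of `y` is retracted to the vertical segment at the centre, and the wall
  -- over the arm of `x` is then swept downwards.
  have h1 := Y.arm_collapse (R := R ∪ carrier (lift W (Y.arm f x))) hW hy ?_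
  · have h2 := Y.arm_lower_foot (R := R) hW hx
      fun z hz => hR ⟨hz.1, wall_mono Set.subset_union_left _ hz.2⟩
    refine (h1.congr ?_ rfl).trans (h2.congr ?_ rfl) <;>
    · ext z; simp only [Set.mem_union]; tauto
  · rintro z ⟨hz | hz, hz'⟩
    · rcases hR ⟨hz, wall_mono Set.subset_union_right _ hz'⟩ with rfl | rfl
      · exact Or.inl rfl
      · exact absurd hz' (Y.pos_notMem_wall hW hy hxy)
    · exact Or.inr (Y.lift_arm_inter_wall hW hx hy hxy ⟨hz, hz'⟩)

/-- An edge of the triangle and the arms that it follows form a trivial knot. -/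
lemma newArc_trivial (hw : Thick f.image w) (hT : s(x, y) ∈ triangleEdges a b c)
    (h0 : level a b c s(x, y) ≠ 0) :
    IsTrivialKnot (carrier (Y.newArc f w x y) ∪ (carrier (Y.arm f x) ∪ carrier (Y.arm f y))) := by
  have hx := Y.adj_centre_of_mem hT
  have hy := Y.adj_centre_of_mem' hT
  have hxy := (Y.adj_of_mem hT).ne
  rw [Y.carrier_newArc_of_mem f w hT]
  have hW := hw.smul (abs_level_le a b c s(x, y)) h0
  set W := level a b c s(x, y) • w
  -- Retracting the wall over the arm of `y` leaves the boundary of the wall over the arm of `x`.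
  have h1 := Y.arm_collapse (R := carrier (lift W (Y.arm f x)) ∪ carrier (Y.arm f x)) hW hy ?_
  · refine IsTrivialKnot.of_equiv (h1.congr ?_ (Set.union_comm _ _)) (Y.arm_trivial hW hx)
    ext z; simp only [Set.mem_union]; tauto
  · rintro z ⟨hz | hz, hz'⟩
    · exact Or.inr (Y.lift_arm_inter_wall hW hx hy hxy ⟨hz, hz'⟩)
    · exact Or.inl (Y.arm_inter_wall hW hx hy hxy ⟨hz, hz'⟩)

/-- The wall between an edge of the triangle and the Y meets the Y-graph only in the Y. -/
lemma inter_wall_subset (hw : Thick f.image w) (hT : s(x, y) ∈ triangleEdges a b c) {z : Space}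
    (hz : z ∈ f.image)
    (hz' : z ∈ wall (carrier (Y.arm f x) ∪ carrier (Y.arm f y)) (level a b c s(x, y) • w)) :
    z ∈ carrier (Y.arm f x) ∪ carrier (Y.arm f y) := by
  obtain ⟨p, hp, t, h0, h1, he⟩ := hz'
  rw [smul_smul] at he
  have := hw.eq_and_eq (s := 0) hz (Set.union_subset (f.carrier_arc_subset (Y.adj_centre_of_mem hT))
      (f.carrier_arc_subset (Y.adj_centre_of_mem' hT)) hp) (by simp) (abs_mul_level_le h0 h1 _)
      (by simpa using he)
  rw [this.1]; exact hp

/-- The wall between an edge of the triangle and the Y meets the other edges of the triangle only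
in vertices. -/
lemma newArc_inter_wall (hw : Thick f.image w) {u v : V} (hT : s(x, y) ∈ triangleEdges a b c)
    (hT' : s(u, v) ∈ triangleEdges a b c) (hne : s(u, v) ≠ s(x, y))
    (hl : level a b c s(u, v) ≠ 0) {z : Space} (hz : z ∈ carrier (Y.newArc f w u v))
    (hz' : z ∈ wall (carrier (Y.arm f x) ∪ carrier (Y.arm f y)) (level a b c s(x, y) • w)) :
    (z = f.pos (Y.ι u) ∨ z = f.pos (Y.ι v)) ∧ (z = f.pos (Y.ι x) ∨ z = f.pos (Y.ι y)) := by
  obtain ⟨p, hp, t, h0, h1, rfl, hlast⟩ := Y.exists_of_mem_newArc hz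
  obtain ⟨p', hp', t', h0', h1', he⟩ := id hz'
  rw [smul_smul] at he
  have hsub := Set.union_subset (f.carrier_arc_subset (Y.adj_centre_of_mem hT))
      (f.carrier_arc_subset (Y.adj_centre_of_mem' hT))
  obtain ⟨rfl, heq⟩ := hw.eq_and_eq (Y.base_subset (Y.adj_of_mem hT') hp) (hsub hp')
    (abs_mul_level_le h0 h1 _) (abs_mul_level_le h0' h1' _) he
  have hlev : t * level a b c s(u, v) = 0 := by
    have : (t * level a b c s(u, v)) ^ 2
        = (t * t') * (level a b c s(u, v) * level a b c s(x, y)) := by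
      rw [sq]; nth_rewrite 2 [heq]; ring
    have h2 : (t * level a b c s(u, v)) ^ 2 ≤ 0 := by
      rw [this]
      exact mul_nonpos_of_nonneg_of_nonpos (by positivity) (level_mul_nonpos hT' hT hne).2
    exact pow_eq_zero_iff (two_ne_zero) |>.1 (le_antisymm h2 (sq_nonneg _))
  rw [hlev, zero_smul, add_zero]
  have hp3 := hlast hlev hl
  refine ⟨hp3, ?_⟩
  have key : ∀ r, p = f.pos (Y.ι r) → p = f.pos (Y.ι x) ∨ p = f.pos (Y.ι y) := by
    rintro r rfl
    rcases hp' with h | h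
    · rw [Y.eq_of_pos_mem_arm (Y.adj_centre_of_mem hT) h]; exact Or.inl rfl
    · rw [Y.eq_of_pos_mem_arm (Y.adj_centre_of_mem' hT) h]; exact Or.inr rfl
  rcases hp3 with h | h
  exacts [key _ h, key _ h]

end YMove
end
end KnotLink

namespace KnotLink

/-! ### Images of walks -/

section
variable {V : Type*} {G : SimpleGraph V}
open SimpleGraph

namespace SpatialGraph
variable (f : SpatialGraph G)

lemma exists_track_eq {u v : V} (p : G.Walk u v) : ∃ l, f.track p = f.pos u :: l := by
  cases p with
  | nil => exact ⟨_, rfl⟩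
  | cons h p => exact ⟨_, rfl⟩

lemma carrier_track_cons {u v x : V} (h : G.Adj u v) (p : G.Walk v x) :
    carrier (f.track (.cons h p)) = carrier (f.arc u v) ∪ carrier (f.track p) := by
  obtain ⟨l, hl⟩ := f.exists_track_eq p
  rw [track, hl, ← List.cons_append, carrier_append_cons]
  rfl

lemma edges_track {u v : V} (p : G.Walk u v) :
    edges (f.track p) = p.darts.flatMap fun d => edges (f.arc d.fst d.snd) := by
  induction p with
  | nil => rfl
  | @cons u v x h p ih =>
    obtain ⟨l, hl⟩ := f.exists_track_eq p
    rw [Walk.darts_cons, List.flatMap_cons, ← ih, track, hl, ← List.cons_append, edges_append_cons]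
    rfl

lemma mem_carrier_track {u v : V} {p : G.Walk u v} (hp : ¬ p.Nil) {z : Space} :
    z ∈ carrier (f.track p) ↔ ∃ x y, s(x, y) ∈ p.edges ∧ z ∈ carrier (f.arc x y) := by
  induction p with
  | nil => simp at hp
  | @cons u v x h p ih =>
    rw [carrier_track_cons]
    constructor
    · rintro (hz | hz)
      · exact ⟨u, v, by simp, hz⟩
      · by_cases hn : p.Nil
        · have := hn.eq
          subst this
          obtain rfl : p = .nil := Walk.eq_nil_iff_nil.2 hn
          obtain rfl : z = f.pos v := hz
          exact ⟨u, v, by simp, mem_carrier_of_mem (by simp [arc])⟩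
        · obtain ⟨x, y, h1, h2⟩ := (ih hn).1 hz
          exact ⟨x, y, by simp [h1], h2⟩
    · rintro ⟨x, y, h1, hz⟩
      rw [Walk.edges_cons, List.mem_cons] at h1
      rcases h1 with h1 | h1
      · left
        rcases Sym2.eq_iff.1 h1 with ⟨rfl, rfl⟩ | ⟨rfl, rfl⟩
        · exact hz
        · rwa [f.carrier_arc_symm h] at hz
      · right
        have hn : ¬ p.Nil := fun hn => by
          cases p with
          | nil => simp at h1
          | cons h p => simp at hn
        exact (ih hn).2 ⟨x, y, h1, hz⟩

/-- As a point set, a knot depends only on the edges of its cycle, so cycles may be rotated and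
reversed freely in the argument on knots. -/
lemma carrier_track_congr {u v u' v' : V} {p : G.Walk u v} {p' : G.Walk u' v'} (hp : ¬ p.Nil)
    (hp' : ¬ p'.Nil) (h : ∀ e, e ∈ p.edges ↔ e ∈ p'.edges) :
    carrier (f.track p) = carrier (f.track p') := by
  ext z
  rw [f.mem_carrier_track hp, f.mem_carrier_track hp']
  simp only [h]

/-- Vertex-disjoint cycles have disjoint images. -/
lemma disjoint_carrier_track {u v u' v' : V} {p : G.Walk u v} {p' : G.Walk u' v'} (hp : ¬ p.Nil)
    (hp' : ¬ p'.Nil) (h : ∀ x ∈ p.support, x ∉ p'.support) :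
    Disjoint (carrier (f.track p)) (carrier (f.track p')) := by
  rw [Set.disjoint_left]
  intro z hz hz'
  obtain ⟨x, y, hxy, hz⟩ := (f.mem_carrier_track hp).1 hz
  obtain ⟨x', y', hxy', hz'⟩ := (f.mem_carrier_track hp').1 hz'
  have h1 := p.fst_mem_support_of_mem_edges hxy
  have h2 := p.snd_mem_support_of_mem_edges hxy
  have h3 := p'.fst_mem_support_of_mem_edges hxy'
  have h4 := p'.snd_mem_support_of_mem_edges hxy'
  obtain ⟨t, ⟨ht, ht'⟩, -⟩ := f.arc_arc x y x' y' (p.adj_of_mem_edges hxy) (p'.adj_of_mem_edges hxy')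
    (fun he => by
      have : x ∈ s(x', y') := he ▸ Sym2.mem_mk_left x y
      rcases Sym2.mem_iff.1 this with rfl | rfl
      exacts [h _ h1 h3, h _ h1 h4]) ⟨hz, hz'⟩
  have ht1 : t ∈ p.support := by rcases ht with rfl | rfl <;> assumption
  have ht2 : t ∈ p'.support := by rcases ht' with rfl | rfl <;> assumption
  exact h t ht1 ht2

end SpatialGraph

/-! ### Rotating cycles -/

lemma isCycle_append_comm {u v : V} {p : G.Walk u v} {q : G.Walk v u} (h : (p.append q).IsCycle) :
    (q.append p).IsCycle := by
  rw [Walk.isCycle_def, Walk.isTrail_def] at h ⊢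
  refine ⟨?_, ?_, ?_⟩
  · rw [Walk.edges_append] at h ⊢
    exact (List.perm_append_comm.nodup_iff).1 h.1
  · intro hn
    have h2 := congrArg Walk.length hn
    have h3 : (p.append q).length = 0 := by
      rw [Walk.length_append] at h2 ⊢
      simp only [Walk.length_nil] at h2
      omega
    exact h.2.1 (Walk.eq_nil_iff_nil.2 (Walk.length_eq_zero_iff.1 h3))
  · rw [Walk.tail_support_append] at h ⊢
    exact (List.perm_append_comm.nodup_iff).1 h.2.2

lemma exists_append_of_mem_darts {u v : V} {p : G.Walk u v} {d : G.Dart} (hd : d ∈ p.darts) :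
    ∃ (p₁ : G.Walk u d.fst) (p₂ : G.Walk d.snd v), p = p₁.append (.cons d.adj p₂) := by
  induction p with
  | nil => simp at hd
  | @cons u v x h p ih =>
    rw [Walk.darts_cons, List.mem_cons] at hd
    rcases hd with rfl | hd
    · exact ⟨.nil, p, rfl⟩
    · obtain ⟨p₁, p₂, rfl⟩ := ih hd
      exact ⟨.cons h p₁, p₂, rfl⟩

/-- Rotation preserves the darts, not merely the edges; linking numbers require this, since crossing
signs depend on orientation. -/
lemma exists_isCycle_cons_of_mem_darts {u : V} {p : G.Walk u u} (hp : p.IsCycle) {d : G.Dart}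
    (hd : d ∈ p.darts) : ∃ q : G.Walk d.snd d.fst, (Walk.cons d.adj q).IsCycle ∧
      (Walk.cons d.adj q).darts.Perm p.darts := by
  obtain ⟨p₁, p₂, rfl⟩ := exists_append_of_mem_darts hd
  refine ⟨p₂.append p₁, isCycle_append_comm hp, ?_⟩
  rw [← Walk.cons_append, Walk.darts_append, Walk.darts_append]
  exact List.perm_append_comm

lemma mem_edges_congr {u v u' v' : V} {p : G.Walk u v} {q : G.Walk u' v'}
    (h : p.darts.Perm q.darts) (e : Sym2 V) : e ∈ p.edges ↔ e ∈ q.edges :=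
  (h.map _).mem_iff

/-- Only edges are preserved here, because the cycle may have to be reversed to traverse the edge
from `x` to `y`. -/
lemma exists_isCycle_cons {u : V} {p : G.Walk u u} (hp : p.IsCycle) {x y : V} (h : G.Adj x y)
    (hxy : s(x, y) ∈ p.edges) : ∃ q : G.Walk y x, (Walk.cons h q).IsCycle ∧
      ∀ e, e ∈ (Walk.cons h q).edges ↔ e ∈ p.edges := by
  have key : ∀ p : G.Walk u u, p.IsCycle → (⟨(x, y), h⟩ : G.Dart) ∈ p.darts →
      ∃ q : G.Walk y x, (Walk.cons h q).IsCycle ∧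
        ∀ e, e ∈ (Walk.cons h q).edges ↔ e ∈ p.edges := by
    intro p hp hd
    obtain ⟨q, hq, hperm⟩ := exists_isCycle_cons_of_mem_darts hp hd
    exact ⟨q, hq, mem_edges_congr hperm⟩
  obtain ⟨d, hd, he⟩ := List.mem_map.1 hxy
  rcases SimpleGraph.dart_edge_eq_mk'_iff.1 he with h1 | h1
  · refine key p hp ?_
    have : d = ⟨(x, y), h⟩ := SimpleGraph.Dart.ext _ _ h1
    rwa [← this]
  · obtain ⟨q, hq, hq'⟩ := key p.reverse hp.reverse (by
      have : d.symm = ⟨(x, y), h⟩ := SimpleGraph.Dart.ext _ _ (by simp [SimpleGraph.Dart.symm, h1])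
      rw [← this]
      simpa using hd)
    refine ⟨q, hq, fun e => (hq' e).trans (by simp)⟩

lemma exists_cons_of_isPath {u v x : V} {p : G.Walk u v} (hp : p.IsPath) (h : s(u, x) ∈ p.edges) :
    ∃ (hux : G.Adj u x) (q : G.Walk x v), p = .cons hux q := by
  cases p with
  | nil => simp at h
  | @cons _ y _ huy q =>
    rw [Walk.edges_cons, List.mem_cons] at h
    rcases h with h | h
    · obtain rfl : x = y := Sym2.congr_right.1 h
      exact ⟨huy, q, rfl⟩
    · exact absurd (q.fst_mem_support_of_mem_edges h) ((Walk.cons_isPath_iff _ _).1 hp).2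

lemma exists_isCycle_cons_cons {u : V} {p : G.Walk u u} (hp : p.IsCycle) {x y z : V}
    (h : G.Adj x y) (h' : G.Adj y z) (hxz : x ≠ z) (hxy : s(x, y) ∈ p.edges)
    (hyz : s(y, z) ∈ p.edges) : ∃ q : G.Walk z x, (Walk.cons h (.cons h' q)).IsCycle ∧
      ∀ e, e ∈ (Walk.cons h (.cons h' q)).edges ↔ e ∈ p.edges := by
  obtain ⟨q, hq, hqe⟩ := exists_isCycle_cons hp h hxy
  have h2 := (hqe _).2 hyz
  rw [Walk.edges_cons, List.mem_cons] at h2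
  have h3 := h2.resolve_left (fun he => by
    rw [Sym2.eq_swap, Sym2.congr_left] at he
    exact hxz he.symm)
  obtain ⟨hux, q', rfl⟩ := exists_cons_of_isPath ((Walk.cons_isCycle_iff _ _).1 hq).1 h3
  exact ⟨q', hq, hqe⟩

end
end KnotLink

namespace KnotLink
open SimpleGraph

/-! ### Cycles through a triangle -/

section
variable {V V' : Type*} {G : SimpleGraph V} {G' : SimpleGraph V'} {a b c : V}

lemma exists_of_ne_of_mem_triangleEdges {e e' : Sym2 V} (he : e ∈ triangleEdges a b c)
    (he' : e' ∈ triangleEdges a b c) (hne : e ≠ e') :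
    ∃ x y z, e = s(x, y) ∧ e' = s(y, z) ∧ x ≠ z := by
  have key : ∃ x y z, e = s(x, y) ∧ e' = s(y, z) := by
    rcases he with rfl | rfl | rfl <;> rcases he' with rfl | rfl | rfl
    · exact absurd rfl hne
    · exact ⟨_, _, _, rfl, rfl⟩
    · exact ⟨b, a, c, Sym2.eq_swap, Sym2.eq_swap⟩
    · exact ⟨c, b, a, Sym2.eq_swap, Sym2.eq_swap⟩
    · exact absurd rfl hne
    · exact ⟨_, _, _, rfl, rfl⟩
    · exact ⟨_, _, _, rfl, rfl⟩
    · exact ⟨a, c, b, Sym2.eq_swap, Sym2.eq_swap⟩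
    · exact absurd rfl hne
  obtain ⟨x, y, z, rfl, rfl⟩ := key
  exact ⟨x, y, z, rfl, rfl, fun h => hne (by rw [h, Sym2.eq_swap])⟩

lemma triangleEdges_eq {x y z : V} (hxy : s(x, y) ∈ triangleEdges a b c)
    (hyz : s(y, z) ∈ triangleEdges a b c) (hxz : x ≠ z) (h1 : x ≠ y) (h2 : y ≠ z) :
    triangleEdges a b c = {s(x, y), s(y, z), s(z, x)} := by
  simp only [triangleEdges, Set.mem_insert_iff, Set.mem_singleton_iff, Sym2.eq_iff] at hxy hyz
  ext e
  induction e using Sym2.ind with | _ u v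
  simp only [triangleEdges, Set.mem_insert_iff, Set.mem_singleton_iff, Sym2.eq_iff]
  grind

namespace YMove
variable (Y : YMove G G' a b c)

/-- The inclusion of the graph without the triangle. -/
def incl : G.deleteEdges (triangleEdges a b c) →g G' where
  toFun := Y.ι
  map_rel' := fun {x y} h => (Y.adj_ι x y).2 (deleteEdges_adj.1 h)

/-- The walk in `G'` with the same edges as a walk outside the triangle. -/
def mapWalk {x y : V} (q : (G.deleteEdges (triangleEdges a b c)).Walk x y) :
    G'.Walk (Y.ι x) (Y.ι y) := q.map Y.incl

lemma support_mapWalk {x y : V} (q : (G.deleteEdges (triangleEdges a b c)).Walk x y) :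
    (Y.mapWalk q).support = q.support.map Y.ι := Walk.support_map _ _

lemma edges_mapWalk {x y : V} (q : (G.deleteEdges (triangleEdges a b c)).Walk x y) :
    (Y.mapWalk q).edges = q.edges.map (Sym2.map Y.ι) := Walk.edges_map _ _

lemma nil_mapWalk {x y : V} (q : (G.deleteEdges (triangleEdges a b c)).Walk x y) :
    (Y.mapWalk q).Nil ↔ q.Nil := Walk.nil_map_iff _

lemma isPath_mapWalk {x y : V} {q : (G.deleteEdges (triangleEdges a b c)).Walk x y} :
    (Y.mapWalk q).IsPath ↔ q.IsPath := Walk.isPath_map_iff_of_injective Y.ι_injective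

lemma isCycle_mapWalk {x : V} {q : (G.deleteEdges (triangleEdges a b c)).Walk x x} :
    (Y.mapWalk q).IsCycle ↔ q.IsCycle := Walk.isCycle_map_iff_of_injective Y.ι_injective

lemma exists_mapWalk_eq {u v : V'} (p : G'.Walk u v) (hp : Y.centre ∉ p.support) :
    ∀ (x y : V) (hx : u = Y.ι x) (hy : v = Y.ι y),
      ∃ q : (G.deleteEdges (triangleEdges a b c)).Walk x y, Y.mapWalk q = p.copy hx hy := by
  induction p with
  | nil =>
    rintro x y rfl hy
    obtain rfl := Y.ι_injective hy
    exact ⟨.nil, rfl⟩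
  | @cons u t v h p ih =>
    rintro x y rfl rfl
    rw [Walk.support_cons, List.mem_cons, not_or] at hp
    rcases Y.eq_or t with rfl | ⟨s, rfl⟩
    · exact absurd p.start_mem_support hp.2
    · obtain ⟨q, hq⟩ := ih hp.2 s y rfl rfl
      refine ⟨.cons (deleteEdges_adj.2 ((Y.adj_ι x s).1 h)) q, ?_⟩
      exact congrArg (Walk.cons h) hq

lemma centre_notMem_mapWalk {x y : V} (q : (G.deleteEdges (triangleEdges a b c)).Walk x y) :
    Y.centre ∉ (Y.mapWalk q).support := by
  rw [support_mapWalk, List.mem_map]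
  rintro ⟨z, -, hz⟩
  exact Y.ι_ne z hz

/-- A path outside the triangle is closed to a cycle through the centre of the Y. -/
def throughCentre {x y : V} (hx : G'.Adj Y.centre (Y.ι x)) (hy : G'.Adj Y.centre (Y.ι y))
    (q : (G.deleteEdges (triangleEdges a b c)).Walk y x) : G'.Walk (Y.ι x) (Y.ι x) :=
  .cons hx.symm (.cons hy (Y.mapWalk q))

lemma isCycle_throughCentre {x y : V} (hx : G'.Adj Y.centre (Y.ι x))
    (hy : G'.Adj Y.centre (Y.ι y)) (hxy : x ≠ y)
    {q : (G.deleteEdges (triangleEdges a b c)).Walk y x} (hq : q.IsPath) :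
    (Y.throughCentre hx hy q).IsCycle := by
  rw [throughCentre, Walk.cons_isCycle_iff, Walk.cons_isPath_iff]
  refine ⟨⟨Y.isPath_mapWalk.2 hq, Y.centre_notMem_mapWalk q⟩, ?_⟩
  rw [Walk.edges_cons, List.mem_cons, not_or]
  refine ⟨fun h => ?_, fun h => Y.centre_notMem_mapWalk q (Walk.snd_mem_support_of_mem_edges _ h)⟩
  rw [Sym2.eq_swap, Sym2.congr_right] at h
  exact hxy (Y.ι_injective h)

/-- A path outside the triangle is closed by an edge of the triangle. -/
def throughEdge {x y : V} (h : s(x, y) ∈ triangleEdges a b c)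
    (q : (G.deleteEdges (triangleEdges a b c)).Walk y x) : G.Walk x x :=
  .cons (Y.adj_of_mem h) (q.mapLe (deleteEdges_le _))

lemma notMem_edges_of_mem {x y : V} (q : (G.deleteEdges (triangleEdges a b c)).Walk y x)
    {e : Sym2 V} (he : e ∈ q.edges) : e ∉ triangleEdges a b c := by
  have := q.edges_subset_edgeSet he
  rw [edgeSet_deleteEdges] at this
  exact this.2

lemma isCycle_throughEdge {x y : V} (h : s(x, y) ∈ triangleEdges a b c)
    {q : (G.deleteEdges (triangleEdges a b c)).Walk y x} (hq : q.IsPath) :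
    (Y.throughEdge h q).IsCycle := by
  rw [throughEdge, Walk.cons_isCycle_iff]
  refine ⟨hq.mapLe _, fun he => ?_⟩
  rw [Walk.edges_mapLe_eq_edges] at he
  exact notMem_edges_of_mem q he h

/-- A cycle contains no edge, one edge, two edges or all edges of a triangle. -/
lemma cycle_cases (Y : YMove G G' a b c) {u : V} {p : G.Walk u u} (hp : p.IsCycle) :
    (∃ (x : V) (q : (G.deleteEdges (triangleEdges a b c)).Walk x x), q.IsCycle ∧
      ∀ e, e ∈ p.edges ↔ e ∈ q.edges) ∨
    (∃ (x y : V) (q : (G.deleteEdges (triangleEdges a b c)).Walk y x),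
      s(x, y) ∈ triangleEdges a b c ∧ q.IsPath ∧ ∀ e, e ∈ p.edges ↔ e = s(x, y) ∨ e ∈ q.edges) ∨
    (∃ (x y z : V) (q : (G.deleteEdges (triangleEdges a b c)).Walk z x),
      s(x, y) ∈ triangleEdges a b c ∧ s(y, z) ∈ triangleEdges a b c ∧ x ≠ z ∧ q.IsPath ∧
      y ∉ q.support ∧ ∀ e, e ∈ p.edges ↔ e = s(x, y) ∨ e = s(y, z) ∨ e ∈ q.edges) ∨
    ∀ e, e ∈ p.edges ↔ e ∈ triangleEdges a b c := by
  by_cases h2 : ∃ x y z, s(x, y) ∈ triangleEdges a b c ∧ s(y, z) ∈ triangleEdges a b c ∧ x ≠ z ∧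
      s(x, y) ∈ p.edges ∧ s(y, z) ∈ p.edges
  · obtain ⟨x, y, z, hxyT, hyzT, hxz, hxy, hyz⟩ := h2
    have hA := Y.adj_of_mem hxyT
    have hA' := Y.adj_of_mem hyzT
    obtain ⟨q, hq, hqe⟩ := exists_isCycle_cons_cons hp hA hA' hxz hxy hyz
    rw [Walk.cons_isCycle_iff, Walk.cons_isPath_iff, Walk.edges_cons, List.mem_cons, not_or] at hq
    obtain ⟨⟨hqp, hyq⟩, -, hxyq⟩ := hq
    have hyzq : s(y, z) ∉ q.edges := fun h => hyq (Walk.fst_mem_support_of_mem_edges _ h)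
    by_cases hT : ∃ e ∈ q.edges, e ∈ triangleEdges a b c
    · right; right; right
      have hTeq := triangleEdges_eq hxyT hyzT hxz hA.ne hA'.ne
      obtain ⟨e, he, heT⟩ := hT
      rw [hTeq] at heT
      have hzx : s(z, x) ∈ q.edges := by
        rcases heT with rfl | rfl | rfl
        exacts [absurd he hxyq, absurd he hyzq, he]
      -- The path from `z` to `x` starts with the edge `zx`; what follows is a path from `x` to
      -- itself, hence trivial.
      obtain ⟨hzx', q', rfl⟩ := exists_cons_of_isPath hqp hzx
      obtain rfl : q' = .nil := Walk.eq_nil_iff_nil.2 (Walk.isPath_iff_nil.1 ((Walk.cons_isPath_iff _ _).1 hqp).1)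
      intro e
      rw [← hqe, hTeq]
      simp
    · right; right; left
      push Not at hT
      refine ⟨x, y, z, q.toDeleteEdges _ hT, hxyT, hyzT, hxz, ?_, ?_, ?_⟩
      · exact hqp.toDeleteEdges _ _ _
      · simpa [Walk.toDeleteEdges] using hyq
      · intro e
        rw [← hqe]
        simp [Walk.toDeleteEdges]
  · by_cases h1 : ∃ e ∈ p.edges, e ∈ triangleEdges a b c
    · right; left
      obtain ⟨e, he, heT⟩ := h1
      induction e using Sym2.ind with | _ x y
      obtain ⟨q, hq, hqe⟩ := exists_isCycle_cons hp (Y.adj_of_mem heT) he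
      rw [Walk.cons_isCycle_iff] at hq
      have hT : ∀ e ∈ q.edges, e ∉ triangleEdges a b c := by
        intro e' he' he'T
        obtain ⟨x', y', z', h3, h4, h5⟩ := exists_of_ne_of_mem_triangleEdges heT he'T
          (fun h => hq.2 (h ▸ he'))
        refine h2 ⟨x', y', z', h3 ▸ heT, h4 ▸ he'T, h5, h3 ▸ he, h4 ▸ (hqe _).1 ?_⟩
        simp [he']
      refine ⟨x, y, q.toDeleteEdges _ hT, heT, hq.1.toDeleteEdges _ _ _, fun e => ?_⟩
      rw [← hqe]
      simp [Walk.toDeleteEdges]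
    · left
      push Not at h1
      exact ⟨u, p.toDeleteEdges _ h1, hp.toDeleteEdges _ _ _, fun e => by simp [Walk.toDeleteEdges]⟩

/-! ### Knots -/

variable {Y} {f : SpatialGraph G'} {w : Space}

/-- Edges outside the triangle keep their arcs. The equality is one of point lists, as crossing sums
require, and not only of carriers. -/
lemma track_embed_mapLe (hw : Thick f.image w) {x y : V} (q : (G.deleteEdges (triangleEdges a b c)).Walk x y) :
    (Y.embed w hw).track (q.mapLe (deleteEdges_le _)) = f.track (Y.mapWalk q) := by
  induction q with
  | nil => rfl
  | @cons x y z h q ih =>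
    have : Y.bend f w x y = f.bend (Y.ι x) (Y.ι y) := by
      rw [bend, if_neg (deleteEdges_adj.1 h).2]
    exact congrArg (f.pos (Y.ι x) :: ·) (congrArg₂ (· ++ ·) this ih)

lemma carrier_track_throughCentre {x y : V} (hx : G'.Adj Y.centre (Y.ι x))
    (hy : G'.Adj Y.centre (Y.ι y)) (q : (G.deleteEdges (triangleEdges a b c)).Walk y x) :
    carrier (f.track (Y.throughCentre hx hy q)) =
      carrier (f.track (Y.mapWalk q)) ∪ (carrier (Y.arm f x) ∪ carrier (Y.arm f y)) := by
  rw [throughCentre, f.carrier_track_cons, f.carrier_track_cons, f.carrier_arc_symm hx]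
  ext z; simp only [Set.mem_union]; tauto

lemma mem_image_of_mem_track {u v : V'} (p : G'.Walk u v) {z : Space}
    (hz : z ∈ carrier (f.track p)) : z ∈ f.image := by
  by_cases hp : p.Nil
  · cases p with
    | nil => rw [show z = f.pos u from hz]; exact f.pos_mem_image _
    | cons h p => simp at hp
  · obtain ⟨x, y, h, hz⟩ := (f.mem_carrier_track hp).1 hz
    exact f.carrier_arc_subset (p.adj_of_mem_edges h) hz

lemma track_inter_arm {x y t : V} {q : (G.deleteEdges (triangleEdges a b c)).Walk x y}
    (hq : ¬ q.Nil) (ht : G'.Adj Y.centre (Y.ι t)) {z : Space}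
    (hz : z ∈ carrier (f.track (Y.mapWalk q))) (hz' : z ∈ carrier (Y.arm f t)) :
    z = f.pos (Y.ι t) ∧ t ∈ q.support := by
  obtain ⟨u', v', he, hz⟩ := (f.mem_carrier_track (by rwa [nil_mapWalk])).1 hz
  have hA := Walk.adj_of_mem_edges _ he
  rw [edges_mapWalk, List.mem_map] at he
  obtain ⟨e, he, heq⟩ := he
  induction e using Sym2.ind with | _ u v
  have h1 := Walk.fst_mem_support_of_mem_edges _ he
  have h2 := Walk.snd_mem_support_of_mem_edges _ he
  rw [Sym2.map_mk] at heq
  rcases Sym2.eq_iff.1 heq with ⟨rfl, rfl⟩ | ⟨rfl, rfl⟩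
  · obtain ⟨rfl, h⟩ := Y.arm_inter_arc ht hA hz' hz
    exact ⟨rfl, by rcases h with rfl | rfl <;> assumption⟩
  · obtain ⟨rfl, h⟩ := Y.arm_inter_arc ht hA hz' hz
    exact ⟨rfl, by rcases h with rfl | rfl <;> assumption⟩

/-- The wall below the edge meets the image of `f` only in the two arms, and `q` avoids the centre,
so the rest of the knot touches the wall only in `x` and `y`. -/
lemma knotEquiv_of_one_edge (hw : Thick f.image w) {x y : V} (hT : s(x, y) ∈ triangleEdges a b c)
    (q : (G.deleteEdges (triangleEdges a b c)).Walk y x) :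
    KnotEquiv (carrier (f.track (Y.mapWalk q)) ∪ carrier (Y.newArc f w x y))
      (carrier (f.track (Y.throughCentre (Y.adj_centre_of_mem hT) (Y.adj_centre_of_mem' hT) q))) := by
  have hq : ¬ q.Nil := Walk.not_nil_of_ne (Y.adj_of_mem hT).ne'
  rw [carrier_track_throughCentre]
  refine Y.newArc_lower hw hT fun _ => ?_
  rintro z ⟨hz, hz'⟩
  rcases Y.inter_wall_subset hw hT (mem_image_of_mem_track _ hz) hz' with h | h
  · exact Or.inl (track_inter_arm hq (Y.adj_centre_of_mem hT) hz h).1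
  · exact Or.inr (track_inter_arm hq (Y.adj_centre_of_mem' hT) hz h).1

/-- Once `yz` is swept onto its arms, `xy` and the arm of `y` bound a finger that retracts onto the
arm of `x`, since the rest of the cycle avoids `y`. The edge `xy` must have nonzero level, for
otherwise it would itself run along the arm of `y`. -/
lemma knotEquiv_of_two_edges (hw : Thick f.image w) {x y z : V}
    (hT : s(x, y) ∈ triangleEdges a b c) (hT' : s(y, z) ∈ triangleEdges a b c) (hxz : x ≠ z)
    (h0 : level a b c s(x, y) ≠ 0) {q : (G.deleteEdges (triangleEdges a b c)).Walk z x}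
    (hy : y ∉ q.support) :
    KnotEquiv (carrier (f.track (Y.mapWalk q)) ∪
        (carrier (Y.newArc f w x y) ∪ carrier (Y.newArc f w y z)))
      (carrier (f.track (Y.throughCentre (Y.adj_centre_of_mem hT) (Y.adj_centre_of_mem' hT') q))) := by
  have hq : ¬ q.Nil := Walk.not_nil_of_ne hxz.symm
  have hx := Y.adj_centre_of_mem hT
  have hy' := Y.adj_centre_of_mem hT'
  have hz := Y.adj_centre_of_mem' hT'
  have hxy := (Y.adj_of_mem hT).ne
  have hyz := (Y.adj_of_mem hT').ne
  have hne : s(x, y) ≠ s(y, z) := fun h => by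
    rw [Sym2.eq_swap, Sym2.congr_right] at h
    exact hxz h
  rw [carrier_track_throughCentre]
  set R := carrier (f.track (Y.mapWalk q))
  have h1 := Y.newArc_lower (R := R ∪ carrier (Y.newArc f w x y)) hw hT' fun _ => ?_
  · have h2 := Y.newArc_collapse (R := R ∪ carrier (Y.arm f z)) hw hT h0 ?_
    · refine (h1.congr ?_ rfl).trans (h2.congr ?_ ?_) <;>
      · ext z; simp only [Set.mem_union]; tauto
    · rintro p ⟨hp | hp, hp'⟩
      · rcases Y.inter_wall_subset hw hT (mem_image_of_mem_track _ hp) hp' with h | h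
        · exact Or.inr (track_inter_arm hq hx hp h).1
        · exact absurd (track_inter_arm hq hy' hp h).2 hy
      · rcases Y.inter_wall_subset hw hT (f.carrier_arc_subset hz hp) hp' with h | h
        · exact Or.inl (Y.arm_inter_arm hx hz hxz ⟨h, hp⟩)
        · exact Or.inl (Y.arm_inter_arm hy' hz hyz ⟨h, hp⟩)
  · rintro p ⟨hp | hp, hp'⟩
    · rcases Y.inter_wall_subset hw hT' (mem_image_of_mem_track _ hp) hp' with h | h
      · exact Or.inl (track_inter_arm hq hy' hp h).1
      · exact Or.inr (track_inter_arm hq hz hp h).1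
    · exact (Y.newArc_inter_wall hw hT' hT hne h0 hp hp').2

/-- The edge `bc`, at level zero, is the union of the arms of `b` and `c`. Retracting `ab` together
with the arm of `b` onto the arm of `a` leaves the boundary of the wall between `ca` and the Y. -/
lemma isTrivialKnot_triangle (hw : Thick f.image w) :
    IsTrivialKnot (carrier (Y.newArc f w a b) ∪
      (carrier (Y.newArc f w b c) ∪ carrier (Y.newArc f w c a))) := by
  have hab : s(a, b) ∈ triangleEdges a b c := by simp [triangleEdges]
  have hbc : s(b, c) ∈ triangleEdges a b c := by simp [triangleEdges]
  have hca : s(c, a) ∈ triangleEdges a b c := by simp [triangleEdges]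
  have ha := Y.adj_centre_of_mem hab
  have hb := Y.adj_centre_of_mem hbc
  have hc := Y.adj_centre_of_mem hca
  have nab := Y.hab.ne
  have nbc := Y.hbc.ne
  have nca := Y.hca.ne
  have l1 : level a b c s(a, b) = 1 := by simp [level]
  have l2 : level a b c s(b, c) = 0 := by simp [level, nca, nbc, nbc.symm, nab.symm]
  have l3 : level a b c s(c, a) = -1 := by simp [level, nca, nbc.symm]
  have hne : s(c, a) ≠ s(a, b) := by simp [nca, nbc.symm]
  have e2 : carrier (Y.newArc f w b c) = carrier (Y.arm f b) ∪ carrier (Y.arm f c) := by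
    rw [Y.carrier_newArc_of_mem f w hbc, l2, zero_smul, lift_zero, lift_zero]
  have h1 := Y.newArc_collapse (R := carrier (Y.arm f c) ∪ carrier (Y.newArc f w c a)) hw hab
    (by rw [l1]; norm_num) ?_
  · refine IsTrivialKnot.of_equiv (h1.congr ?_ ?_)
      (Y.newArc_trivial hw hca (by rw [l3]; norm_num))
    · rw [e2]; ext z; simp only [Set.mem_union]; tauto
    · ext z; simp only [Set.mem_union]; tauto
  · rintro p ⟨hp | hp, hp'⟩
    · rcases Y.inter_wall_subset hw hab (f.carrier_arc_subset hc hp) hp' with h | h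
      · exact Or.inl (Y.arm_inter_arm ha hc nca.symm ⟨h, hp⟩)
      · exact Or.inl (Y.arm_inter_arm hb hc nbc ⟨h, hp⟩)
    · obtain ⟨h2, h3⟩ := Y.newArc_inter_wall hw hab hca hne (by rw [l3]; norm_num) hp hp'
      -- The point is an end of both `ab` and `ca`, so it can only be `a`.
      rcases h3 with rfl | rfl
      · exact Or.inr rfl
      · have hinj : ∀ s t, f.pos (Y.ι s) = f.pos (Y.ι t) → s = t :=
          fun s t h => Y.ι_injective (f.pos_injective h)
        rcases h2 with h2 | h2
        exacts [absurd (hinj _ _ h2) nbc, absurd (hinj _ _ h2) nab.symm]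

/-- Every knot in the new embedding is trivial or equivalent to one in the old embedding. -/
lemma isTrivialKnot_or_knotEquiv (hw : Thick f.image w) {u : V} {p : G.Walk u u}
    (hp : p.IsCycle) :
    IsTrivialKnot (carrier ((Y.embed w hw).track p)) ∨
      ∃ (v : V') (p' : G'.Walk v v), p'.IsCycle ∧
        KnotEquiv (carrier ((Y.embed w hw).track p)) (carrier (f.track p')) := by
  have hpn : ¬ p.Nil := hp.not_nil
  rcases Y.cycle_cases hp with ⟨x, q, hq, he⟩ | ⟨x, y, q, hT, hq, he⟩ |
    ⟨x, y, z, q, hT, hT', hxz, hq, hy, he⟩ | he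
  · right
    refine ⟨_, Y.mapWalk q, Y.isCycle_mapWalk.2 hq, ?_⟩
    rw [← track_embed_mapLe hw, (Y.embed w hw).carrier_track_congr hpn (hq.mapLe _).not_nil
      (fun e => by rw [he, Walk.edges_mapLe_eq_edges])]
    exact .refl _
  · right
    refine ⟨_, _, Y.isCycle_throughCentre (Y.adj_centre_of_mem hT) (Y.adj_centre_of_mem' hT)
      (Y.adj_of_mem hT).ne hq, (knotEquiv_of_one_edge hw hT q).congr ?_ rfl⟩
    rw [(Y.embed w hw).carrier_track_congr hpn (Y.isCycle_throughEdge hT hq).not_nil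
      (fun e => by rw [he, throughEdge, Walk.edges_cons, Walk.edges_mapLe_eq_edges, List.mem_cons]),
      throughEdge, SpatialGraph.carrier_track_cons, track_embed_mapLe, Set.union_comm]
    rfl
  · right
    have hcar : carrier ((Y.embed w hw).track p) = carrier (f.track (Y.mapWalk q)) ∪
        (carrier (Y.newArc f w x y) ∪ carrier (Y.newArc f w y z)) := by
      rw [(Y.embed w hw).carrier_track_congr (p' := .cons (Y.adj_of_mem hT)
        (.cons (Y.adj_of_mem hT') (q.mapLe (deleteEdges_le _)))) hpn (by simp)
        (fun e => by rw [he, Walk.edges_cons, Walk.edges_cons, Walk.edges_mapLe_eq_edges,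
          List.mem_cons, List.mem_cons]), SpatialGraph.carrier_track_cons,
          SpatialGraph.carrier_track_cons, track_embed_mapLe, ← Set.union_assoc, Set.union_comm]
      rfl
    have hne : s(x, y) ≠ s(y, z) := fun h => by
      rw [Sym2.eq_swap, Sym2.congr_right] at h
      exact hxz h
    -- The edge to be retracted needs nonzero level. If `xy` has level zero, then `yz` has not, and
    -- the cycle is read backwards.
    by_cases h0 : level a b c s(x, y) = 0
    · have h0' : level a b c s(z, y) ≠ 0 := by
        rw [Sym2.eq_swap, ← h0]
        exact (level_mul_nonpos hT hT' hne).1.symm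
      have hT2 : s(z, y) ∈ triangleEdges a b c := by rwa [Sym2.eq_swap]
      have hT2' : s(y, x) ∈ triangleEdges a b c := by rwa [Sym2.eq_swap]
      refine ⟨_, _, Y.isCycle_throughCentre (Y.adj_centre_of_mem hT2) (Y.adj_centre_of_mem' hT2')
        hxz.symm hq.reverse, (knotEquiv_of_two_edges hw hT2 hT2' hxz.symm h0' (q := q.reverse)
        (by simpa using hy)).congr ?_ rfl⟩
      have e1 : carrier (Y.newArc f w z y) = carrier (Y.newArc f w y z) :=
        (Y.embed w hw).carrier_arc_symm (Y.adj_of_mem hT')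
      have e2 : carrier (Y.newArc f w y x) = carrier (Y.newArc f w x y) :=
        (Y.embed w hw).carrier_arc_symm (Y.adj_of_mem hT)
      have hqn : ¬ q.Nil := Walk.not_nil_of_ne hxz.symm
      rw [hcar, e1, e2, f.carrier_track_congr (p := Y.mapWalk q.reverse) (p' := Y.mapWalk q)
        (by rw [nil_mapWalk]; exact Walk.not_nil_of_ne hxz) (by rwa [nil_mapWalk])
        (fun e => by simp [edges_mapWalk]), Set.union_comm (carrier (Y.newArc f w x y))]
    · exact ⟨_, _, Y.isCycle_throughCentre (Y.adj_centre_of_mem hT) (Y.adj_centre_of_mem' hT')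
        hxz hq, (knotEquiv_of_two_edges hw hT hT' hxz h0 hy).congr hcar rfl⟩
  · left
    convert isTrivialKnot_triangle hw (Y := Y) using 1
    have e1 := (Y.embed w hw).carrier_arc_symm Y.hab
    have e2 := (Y.embed w hw).carrier_arc_symm Y.hbc
    have e3 := (Y.embed w hw).carrier_arc_symm Y.hca
    ext z
    rw [(Y.embed w hw).mem_carrier_track hpn]
    constructor
    · rintro ⟨x, y, h, hz⟩
      rw [he] at h
      simp only [triangleEdges, Set.mem_insert_iff, Set.mem_singleton_iff, Sym2.eq_iff] at h
      rcases h with (⟨rfl, rfl⟩ | ⟨rfl, rfl⟩) | (⟨rfl, rfl⟩ | ⟨rfl, rfl⟩) | (⟨rfl, rfl⟩ | ⟨rfl, rfl⟩)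
      · exact Or.inl hz
      · exact Or.inl (e1 ▸ hz)
      · exact Or.inr (Or.inl hz)
      · exact Or.inr (Or.inl (e2 ▸ hz))
      · exact Or.inr (Or.inr hz)
      · exact Or.inr (Or.inr (e3 ▸ hz))
    · rintro (hz | hz | hz)
      · exact ⟨a, b, (he _).2 (by simp [triangleEdges]), hz⟩
      · exact ⟨b, c, (he _).2 (by simp [triangleEdges]), hz⟩
      · exact ⟨c, a, (he _).2 (by simp [triangleEdges]), hz⟩

end YMove
end
end KnotLink

namespace KnotLink
open SimpleGraph Filter Topology

/-! ### Links -/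

section
variable {V V' : Type*} {G : SimpleGraph V} {G' : SimpleGraph V'} {a b c : V}

lemma exists_dart_snd_eq {u v : V'} {p : G'.Walk u u} (hp : p.IsCycle) (hv : v ∈ p.support) :
    ∃ d ∈ p.darts, d.snd = v := by
  have : v ∈ p.support.tail := by
    rcases (Walk.mem_support_iff _).1 hv with rfl | h
    exacts [Walk.end_mem_tail_support hp.not_nil, h]
  rw [← Walk.map_snd_darts] at this
  simpa using this

lemma exists_adj_of_mem_verts {u v : V'} {p : G'.Walk u u} (hp : p.IsCycle)
    (hv : v ∈ p.toSubgraph.verts) : ∃ y, p.toSubgraph.Adj v y := by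
  obtain ⟨d, hd, rfl⟩ := exists_dart_snd_eq hp ((Walk.mem_verts_toSubgraph _).1 hv)
  refine ⟨d.fst, ?_⟩
  rw [Walk.adj_toSubgraph_iff_mem_edges, Sym2.eq_swap]
  exact List.mem_map.2 ⟨d, hd, rfl⟩

/-- Every vertex of a cycle lies on one of its edges, so the edges determine the subgraph. -/
lemma toSubgraph_eq_of_mem_edges {u v : V'} {p : G'.Walk u u} {q : G'.Walk v v} (hp : p.IsCycle)
    (hq : q.IsCycle) (h : ∀ e, e ∈ p.edges ↔ e ∈ q.edges) : p.toSubgraph = q.toSubgraph := by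
  have hadj : ∀ x y, p.toSubgraph.Adj x y ↔ q.toSubgraph.Adj x y := fun x y => by
    rw [Walk.adj_toSubgraph_iff_mem_edges, Walk.adj_toSubgraph_iff_mem_edges, h]
  refine Subgraph.ext (Set.ext fun v => ⟨fun h => ?_, fun h => ?_⟩) (by ext x y; exact hadj x y)
  · obtain ⟨y, hy⟩ := exists_adj_of_mem_verts hp h
    exact q.toSubgraph.edge_vert ((hadj _ _).1 hy)
  · obtain ⟨y, hy⟩ := exists_adj_of_mem_verts hq h
    exact p.toSubgraph.edge_vert ((hadj _ _).2 hy)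

namespace YMove
variable (Y : YMove G G' a b c)

lemma mem_triangleEdges {x y : V} (hx : G'.Adj Y.centre (Y.ι x)) (hy : G'.Adj Y.centre (Y.ι y))
    (hxy : x ≠ y) : s(x, y) ∈ triangleEdges a b c := by
  rw [Y.adj_centre] at hx hy
  simp only [triangleEdges, Set.mem_insert_iff, Set.mem_singleton_iff, Sym2.eq_iff]
  grind

/-- The subgraph `γ'` of `G'` arises from the subgraph `γ` of `G` by replacing edges of the triangle
by arms of the Y. -/
def Corresponds (γ' : G'.Subgraph) (γ : G.Subgraph) : Prop :=
  (∀ x y, γ'.Adj (Y.ι x) (Y.ι y) ↔ γ.Adj x y ∧ s(x, y) ∉ triangleEdges a b c) ∧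
  ∀ x, γ'.Adj Y.centre (Y.ι x) ↔ ∃ y, γ.Adj x y ∧ s(x, y) ∈ triangleEdges a b c

variable {Y}

/-- This injectivity makes two different links of `G'` yield two different links of `G`. Isolated
vertices have to be excluded since the correspondence speaks only of adjacency. -/
lemma Corresponds.unique {γ₁ γ₂ : G'.Subgraph} {γ : G.Subgraph} (h₁ : Y.Corresponds γ₁ γ)
    (h₂ : Y.Corresponds γ₂ γ) (hv₁ : ∀ v ∈ γ₁.verts, ∃ y, γ₁.Adj v y)
    (hv₂ : ∀ v ∈ γ₂.verts, ∃ y, γ₂.Adj v y) : γ₁ = γ₂ := by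
  have hadj : ∀ x y, γ₁.Adj x y ↔ γ₂.Adj x y := by
    intro x y
    rcases Y.eq_or x with rfl | ⟨x, rfl⟩ <;> rcases Y.eq_or y with rfl | ⟨y, rfl⟩
    · exact ⟨fun h => absurd rfl h.ne, fun h => absurd rfl h.ne⟩
    · rw [h₁.2, h₂.2]
    · rw [Subgraph.adj_comm, Subgraph.adj_comm γ₂, h₁.2, h₂.2]
    · rw [h₁.1, h₂.1]
  refine Subgraph.ext (Set.ext fun v => ⟨fun h => ?_, fun h => ?_⟩) (by ext x y; exact hadj x y)
  · obtain ⟨y, hy⟩ := hv₁ v h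
    exact γ₂.edge_vert ((hadj _ _).1 hy)
  · obtain ⟨y, hy⟩ := hv₂ v h
    exact γ₁.edge_vert ((hadj _ _).2 hy)

lemma Corresponds.mem_verts {γ' : G'.Subgraph} {γ : G.Subgraph} (h : Y.Corresponds γ' γ)
    (hv : ∀ v ∈ γ.verts, ∃ y, γ.Adj v y) {x : V} (hx : x ∈ γ.verts) : Y.ι x ∈ γ'.verts := by
  obtain ⟨y, hy⟩ := hv x hx
  by_cases hT : s(x, y) ∈ triangleEdges a b c
  · exact γ'.edge_vert ((h.2 x).2 ⟨y, hy, hT⟩).symm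
  · exact γ'.edge_vert ((h.1 x y).2 ⟨hy, hT⟩)

lemma corresponds_mapWalk {x : V} (q : (G.deleteEdges (triangleEdges a b c)).Walk x x) :
    Y.Corresponds (Y.mapWalk q).toSubgraph (q.mapLe (deleteEdges_le _)).toSubgraph := by
  refine ⟨fun u v => ?_, fun u => ?_⟩
  · simp only [Walk.adj_toSubgraph_iff_mem_edges, edges_mapWalk, Walk.edges_mapLe_eq_edges]
    rw [← Sym2.map_mk, List.mem_map_of_injective (Sym2.map.injective Y.ι_injective)]
    exact ⟨fun h => ⟨h, notMem_edges_of_mem q h⟩, fun h => h.1⟩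
  · simp only [Walk.adj_toSubgraph_iff_mem_edges, Walk.edges_mapLe_eq_edges]
    constructor
    · exact fun h => absurd (Walk.fst_mem_support_of_mem_edges _ h) (Y.centre_notMem_mapWalk q)
    · rintro ⟨y, h, hT⟩
      exact absurd hT (notMem_edges_of_mem q h)

lemma corresponds_throughCentre {x y : V} (hT : s(x, y) ∈ triangleEdges a b c)
    (q : (G.deleteEdges (triangleEdges a b c)).Walk y x) :
    Y.Corresponds (Y.throughCentre (Y.adj_centre_of_mem hT) (Y.adj_centre_of_mem' hT) q).toSubgraph
      (Y.throughEdge hT q).toSubgraph := by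
  refine ⟨fun u v => ?_, fun u => ?_⟩
  · simp only [Walk.adj_toSubgraph_iff_mem_edges, throughCentre, throughEdge, Walk.edges_cons,
      List.mem_cons, edges_mapWalk, Walk.edges_mapLe_eq_edges]
    rw [← Sym2.map_mk, List.mem_map_of_injective (Sym2.map.injective Y.ι_injective), Sym2.map_mk]
    have h1 : s(Y.ι u, Y.ι v) ≠ s(Y.ι x, Y.centre) := by
      simp [Y.ι_ne]
    have h2 : s(Y.ι u, Y.ι v) ≠ s(Y.centre, Y.ι y) := by
      simp [Y.ι_ne]
    constructor
    · rintro (h | h | h)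
      exacts [absurd h h1, absurd h h2, ⟨Or.inr h, notMem_edges_of_mem q h⟩]
    · rintro ⟨h | h, hT'⟩
      · exact absurd (h ▸ hT) hT'
      · exact Or.inr (Or.inr h)
  · simp only [Walk.adj_toSubgraph_iff_mem_edges, throughCentre, throughEdge, Walk.edges_cons,
      List.mem_cons, Walk.edges_mapLe_eq_edges]
    rw [Sym2.eq_swap (a := Y.ι x), Sym2.congr_right, Sym2.congr_right, Y.ι_injective.eq_iff,
      Y.ι_injective.eq_iff]
    constructor
    · rintro (rfl | rfl | h)
      · exact ⟨y, Or.inl rfl, hT⟩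
      · exact ⟨x, Or.inl Sym2.eq_swap, by rwa [Sym2.eq_swap]⟩
      · exact absurd (Walk.fst_mem_support_of_mem_edges _ h) (Y.centre_notMem_mapWalk q)
    · rintro ⟨z, h | h, hT'⟩
      · rcases Sym2.eq_iff.1 h with ⟨rfl, -⟩ | ⟨rfl, -⟩
        exacts [Or.inl rfl, Or.inr (Or.inl rfl)]
      · exact absurd hT' (notMem_edges_of_mem q h)

/-- A cycle of `G'` corresponds to a cycle of `G` whose image in the new embedding is close to that
of the given cycle. -/
lemma exists_corresponding_cycle (f : SpatialGraph G') (w : Space) {u : V'} {p : G'.Walk u u}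
    (hp : p.IsCycle) :
    ∃ (x : V) (q : G.Walk x x) (L : List (ℝ → Space)), q.IsCycle ∧
      Y.Corresponds p.toSubgraph q.toSubgraph ∧ (∀ g ∈ L, Continuous g) ∧
      (edges (L.map fun g => g 0)).Perm (edges (f.track p)) ∧
      carrier (L.map fun g => g 0) = carrier (f.track p) ∧
      ∀ (t : ℝ) (hw : Thick f.image (t • w)),
        (Y.embed (t • w) hw).track q = L.map fun g => g t := by
  by_cases hc : Y.centre ∈ p.support
  · obtain ⟨d, hd, hdc⟩ := exists_dart_snd_eq hp hc
    obtain ⟨p', hp', hperm⟩ := exists_isCycle_cons_of_mem_darts hp hd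
    obtain ⟨⟨d₁, d₂⟩, hadj⟩ := d
    simp only at hdc p' hp' hperm
    subst hdc
    rcases Y.eq_or d₁ with rfl | ⟨x, rfl⟩
    · exact absurd rfl hadj.ne
    obtain ⟨y, hy, q, hxy, hq, rfl⟩ : ∃ (y : V) (hy : G'.Adj Y.centre (Y.ι y))
        (q : (G.deleteEdges (triangleEdges a b c)).Walk y x), x ≠ y ∧ q.IsPath ∧
        p' = .cons hy (Y.mapWalk q) := by
      rw [Walk.cons_isCycle_iff] at hp'
      obtain ⟨hpath, hnot⟩ := hp'
      obtain ⟨t, ht, p', rfl⟩ := Walk.exists_eq_cons_of_ne (Y.ι_ne x).symm p'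
      rcases Y.eq_or t with rfl | ⟨y, rfl⟩
      · exact absurd rfl ht.ne
      rw [Walk.cons_isPath_iff] at hpath
      obtain ⟨q, hq⟩ := Y.exists_mapWalk_eq p' hpath.2 y x rfl rfl
      rw [Walk.copy_rfl_rfl] at hq
      subst hq
      refine ⟨y, ht, q, ?_, Y.isPath_mapWalk.1 hpath.1, rfl⟩
      rintro rfl
      exact hnot (by simp [Sym2.eq_swap])
    have hT := Y.mem_triangleEdges hadj.symm hy hxy
    have hperm' : (Y.throughCentre (Y.adj_centre_of_mem hT) (Y.adj_centre_of_mem' hT) q).darts.Perm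
      p.darts := hperm
    have hcyc := Y.isCycle_throughCentre (Y.adj_centre_of_mem hT) (Y.adj_centre_of_mem' hT) hxy hq
    have hsub : p.toSubgraph =
        (Y.throughCentre (Y.adj_centre_of_mem hT) (Y.adj_centre_of_mem' hT) q).toSubgraph := by
      exact toSubgraph_eq_of_mem_edges hp hcyc fun e => (mem_edges_congr hperm' e).symm
    -- The path shrinking onto the Y: at `t = 0` it is the given cycle, rotated to start just before
    -- the centre; at `t` it is the new cycle for the translation `t • w`. Only the break points
    -- over the Y move.
    set L : List (ℝ → Space) := (fun _ => f.pos (Y.ι x)) ::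
      ((f.bend (Y.ι x) Y.centre ++ f.pos Y.centre :: f.bend Y.centre (Y.ι y)).map
        (fun p t => p + level a b c s(x, y) • t • w) ++ (f.track (Y.mapWalk q)).map fun p _ => p)
      with hL
    have hL0 : (L.map fun g => g 0) =
        f.track (Y.throughCentre (Y.adj_centre_of_mem hT) (Y.adj_centre_of_mem' hT) q) := by
      simp [hL, throughCentre, SpatialGraph.track, Function.comp_def]
    refine ⟨x, Y.throughEdge hT q, L, Y.isCycle_throughEdge hT hq, ?_, ?_, ?_, ?_, ?_⟩
    · rw [hsub]
      exact corresponds_throughCentre hT q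
    · intro g hg
      rw [hL, List.mem_cons, List.mem_append, List.mem_map, List.mem_map] at hg
      rcases hg with rfl | ⟨p, -, rfl⟩ | ⟨p, -, rfl⟩ <;> fun_prop
    · rw [hL0, f.edges_track, f.edges_track]
      exact hperm'.flatMap_right _
    · rw [hL0]
      exact f.carrier_track_congr hcyc.not_nil hp.not_nil (mem_edges_congr hperm')
    · intro t hw
      rw [throughEdge, SpatialGraph.track, track_embed_mapLe]
      have : (Y.embed (t • w) hw).bend x y =
          (f.bend (Y.ι x) Y.centre ++ f.pos Y.centre :: f.bend Y.centre (Y.ι y)).map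
            (· + level a b c s(x, y) • t • w) := if_pos hT
      rw [this]
      simp [hL, Function.comp_def, embed]
  · rcases Y.eq_or u with rfl | ⟨x, rfl⟩
    · exact absurd p.start_mem_support hc
    obtain ⟨q, hq⟩ := Y.exists_mapWalk_eq p hc x x rfl rfl
    rw [Walk.copy_rfl_rfl] at hq
    subst hq
    have hL : ∀ t : ℝ, (((f.track (Y.mapWalk q)).map fun p (_ : ℝ) => p).map fun g => g t)
        = f.track (Y.mapWalk q) := fun t => by simp [Function.comp_def]
    refine ⟨x, q.mapLe (deleteEdges_le _), (f.track (Y.mapWalk q)).map fun p _ => p,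
      (Y.isCycle_mapWalk.1 hp).mapLe _, corresponds_mapWalk q, ?_, ?_, ?_, ?_⟩
    · intro g hg
      obtain ⟨p, -, rfl⟩ := List.mem_map.1 hg
      fun_prop
    · rw [hL]
    · rw [hL]
    · intro t hw
      rw [hL, track_embed_mapLe]

variable {f : SpatialGraph G'}

/-- The new walks keep the orientations of the old ones and tend to them as `t` goes to 0, so the
given projection stays regular with the same crossing sum. -/
lemma exists_corresponding_link (w : Space) {γ' δ' : G'.Subgraph} {n : ℤ} (hl : IsLink γ' δ')
    (hn : f.HasLinkingNumber γ' δ' n) :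
    ∃ γ δ : G.Subgraph, IsLink γ δ ∧ Y.Corresponds γ' γ ∧ Y.Corresponds δ' δ ∧
      ∀ᶠ t in 𝓝 (0 : ℝ), ∀ hw : Thick f.image (t • w),
        (Y.embed (t • w) hw).HasLinkingNumber γ δ n := by
  obtain ⟨u, v, p, q, π, hp, rfl, hq, rfl, hreg, hsum⟩ := hn
  obtain ⟨x, p', L, hp', hcp, hLc, hLe, hLcar, hLt⟩ := exists_corresponding_cycle (Y := Y) f w hp
  obtain ⟨y, q', M, hq', hcq, hMc, hMe, hMcar, hMt⟩ := exists_corresponding_cycle (Y := Y) f w hq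
  refine ⟨p'.toSubgraph, q'.toSubgraph, ⟨⟨_, p', hp', rfl⟩, ⟨_, q', hq', rfl⟩, ?_⟩, hcp, hcq, ?_⟩
  · rw [Set.disjoint_left]
    intro z hz hz'
    exact Set.disjoint_left.1 hl.2.2 (hcp.mem_verts (fun _ => exists_adj_of_mem_verts hp') hz)
      (hcq.mem_verts (fun _ => exists_adj_of_mem_verts hq') hz')
  · have hdisj : Disjoint (carrier (f.track p)) (carrier (f.track q)) :=
      f.disjoint_carrier_track hp.not_nil hq.not_nil fun x hx hx' =>
        Set.disjoint_left.1 hl.2.2 ((Walk.mem_verts_toSubgraph _).2 hx)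
          ((Walk.mem_verts_toSubgraph _).2 hx')
    filter_upwards [eventually_isRegularProjection hLc hMc
      (isRegularProjection_perm hLe.symm hMe.symm hreg) (by rwa [hLcar, hMcar])] with t ht hw
    refine ⟨x, y, p', q', π, hp', rfl, hq', rfl, ?_, ?_⟩
    · rw [hLt, hMt]; exact ht.1
    · rw [hLt, hMt, ht.2, crossingSum_perm hLe hMe, hsum]

lemma eventually_caLinked (w : Space) (hf : f.CALinked) :
    ∀ᶠ t in 𝓝 (0 : ℝ), ∀ hw : Thick f.image (t • w), (Y.embed (t • w) hw).CALinked := by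
  have hverts : ∀ {γ δ : G'.Subgraph}, IsLink γ δ →
      (∀ v ∈ γ.verts, ∃ y, γ.Adj v y) ∧ ∀ v ∈ δ.verts, ∃ y, δ.Adj v y := by
    rintro γ δ ⟨⟨u, p, hp, rfl⟩, ⟨v, q, hq, rfl⟩, -⟩
    exact ⟨fun _ => exists_adj_of_mem_verts hp, fun _ => exists_adj_of_mem_verts hq⟩
  rcases hf with ⟨γ', δ', n, hl, hn, h2⟩ | ⟨γ₁', δ₁', γ₂', δ₂', n, m, hl, hl', hne, hn, hn0, hm, hm0⟩
  · obtain ⟨γ, δ, hl1, -, -, hev⟩ := exists_corresponding_link (Y := Y) w hl hn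
    filter_upwards [hev] with t ht hw
    exact Or.inl ⟨γ, δ, n, hl1, ht hw, h2⟩
  · obtain ⟨γ₁, δ₁, hl1, hγ₁, hδ₁, hev⟩ := exists_corresponding_link (Y := Y) w hl hn
    obtain ⟨γ₂, δ₂, hl2, hγ₂, hδ₂, hev'⟩ := exists_corresponding_link (Y := Y) w hl' hm
    filter_upwards [hev, hev'] with t ht ht' hw
    -- Were the new links equal as unordered pairs, `Corresponds.unique` would identify the old
    -- ones, possibly with their components exchanged.
    refine Or.inr ⟨γ₁, δ₁, γ₂, δ₂, n, m, hl1, hl2, fun he => hne ?_, ht hw, hn0, ht' hw, hm0⟩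
    rcases Sym2.eq_iff.1 he with ⟨rfl, rfl⟩ | ⟨rfl, rfl⟩
    · rw [hγ₁.unique hγ₂ (hverts hl).1 (hverts hl').1, hδ₁.unique hδ₂ (hverts hl).2 (hverts hl').2]
    · rw [hγ₁.unique hδ₂ (hverts hl).1 (hverts hl').2, hδ₁.unique hγ₂ (hverts hl).2 (hverts hl').1,
        Sym2.eq_swap]

end YMove

/-! ### Translations of the whole image and the conclusion -/

lemma exists_thick_image [Finite V'] (f : SpatialGraph G') :
    ∃ w : Space, ∀ᶠ t : ℝ in 𝓝[>] 0, Thick f.image (t • w) := by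
  -- Degenerate segments are included so that isolated vertices are covered too.
  obtain ⟨w, hw⟩ := exists_thick (S := (Set.range fun u => (f.pos u, f.pos u)) ∪
    ⋃ (u : V') (v : V'), {e | e ∈ edges (f.arc u v)})
    ((Set.finite_range _).union (Set.finite_iUnion fun u => Set.finite_iUnion fun v =>
      List.finite_toSet _))
  refine ⟨w, hw.mono fun t ht => ht.mono ?_⟩
  rintro z (⟨u, rfl⟩ | ⟨u, v, -, hz⟩)
  · exact Set.mem_iUnion₂.2 ⟨(f.pos u, f.pos u), Or.inl ⟨u, rfl⟩, left_mem_segment ℝ _ _⟩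
  · obtain ⟨e, he, hz⟩ : ∃ e ∈ edges (f.arc u v), z ∈ segment ℝ e.1 e.2 := by
      unfold SpatialGraph.arc at hz ⊢
      cases h : f.bend u v <;> rw [h] at hz <;> exact mem_carrier_cons_cons.1 hz
    exact Set.mem_iUnion₂.2 ⟨e, Or.inr (Set.mem_iUnion₂.2 ⟨u, v, he⟩), hz⟩

/-- The model on `Option V` and the isomorphism are used only here; the rest of the argument needs
nothing beyond the adjacencies recorded in `YMove`. -/
lemma nonempty_yMove {a b c : V} (hab : G.Adj a b) (hbc : G.Adj b c) (hca : G.Adj c a)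
    (φ : G' ≃g triangleY G a b c) : Nonempty (YMove G G' a b c) := by
  refine ⟨{ ι := fun x => φ.symm (some x), centre := φ.symm none, ι_injective := ?_, ι_ne := ?_,
            eq_or := ?_, adj_ι := ?_, adj_centre := ?_, hab := hab, hbc := hbc, hca := hca }⟩
  · exact φ.symm.injective.comp (Option.some_injective _)
  · intro x h
    exact Option.some_ne_none x (φ.symm.injective h)
  · intro y
    rcases h : φ y with _ | x
    · exact Or.inl (by rw [← h, RelIso.symm_apply_apply])
    · exact Or.inr ⟨x, by rw [← h, RelIso.symm_apply_apply]⟩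
  · intro x y
    rw [φ.symm.map_adj_iff]
    simp [triangleY, triangleEdges, SimpleGraph.map, Relation.Map]
    exact fun h _ _ _ _ _ _ => h.ne
  · intro x
    rw [φ.symm.map_adj_iff]
    simp [triangleY, SimpleGraph.map, Relation.Map]

end
end KnotLink

theorem mainTheorem4 {V V' : Type*} [Finite V] [Finite V']
    (G : SimpleGraph V) (G' : SimpleGraph V')
    (hmove : KnotLink.IsTriangleYMove G G') (hG : KnotLink.KLinked G) :
    KnotLink.KLinked G' := by
  intro f hf
  obtain ⟨a, b, c, hab, hbc, hca, ⟨φ⟩⟩ := hmove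
  obtain ⟨Y⟩ := KnotLink.nonempty_yMove hab hbc hca φ
  obtain ⟨w, hw⟩ := KnotLink.exists_thick_image f
  -- Thickness holds for small positive `t` and the linking condition for all `t` near 0, so a
  -- common `t > 0` exists.
  obtain ⟨t, ht, hlink⟩ :=
    (hw.and (nhdsWithin_le_nhds (KnotLink.YMove.eventually_caLinked (Y := Y) w hf))).exists
  obtain ⟨u, p, hp, hK⟩ := hG _ (hlink ht)
  obtain ⟨v, p', hp', he⟩ := (KnotLink.YMove.isTrivialKnot_or_knotEquiv ht hp).resolve_left hK
  exact ⟨v, p', hp', fun h => hK (.of_equiv he h)⟩
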